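/- Let $\mathbb K$ be an algebraically closed field of characteristic zero, $M$ a lattice of finite rank, $N=\mathrm{Hom}(M,\mathbb Z)$, and let $\sigma^\vee\subset M_{\mathbb Q}$ be a rational (finitely generated) convex cone with nonempty interior which contains no line. Let $A=\bigoplus_{m\in\sigma^\vee\cap M}\mathbb K\chi^m$, let $X=\operatorname{Spec}A$ be the corresponding toric affine variety without torus factor, and let $\mathbb T=\mathrm{Hom}(M,\mathbb K^*)$ be its acting torus, $t.\chi^m=t(m)\chi^m$. Let $\Xi\subset N$ be the set of primitive generators of the extremal rays of the dual cone $\sigma\subset N_{\mathbb Q}$. For $\rho\in\Xi$ let $\mathcal S_\rho\cap M$ be the set of Demazure roots belonging to $\rho$, that is, of $e\in M$ with $\langle\rho,e\rangle=-1$ and $\langle\rho',e\rangle\ge 0$ for all $\rho'\in\Xi\setminus\{\rho\}$; for such a root put $\partial_{\rho,e}(\chi^m)=\langle\rho,m\rangle\chi^{m+e}$ and $H_e=\exp(\mathbb K\partial_{\rho,e})$. A derivation $\partial$ of $A$ is a finite sum of its homogeneous components $\partial_e$, $e\in M$; its Newton polytope $N(\partial)\subset M_{\mathbb Q}$ is the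 convex hull of $\{e:\partial_e\ne 0\}$. For $\rho\in N$ let $T=R_\rho\subset\mathbb T$ be the one-parameter subgroup $s.\chi^m=s^{\langle\rho,m\rangle}\chi^m$, $s\in\mathbb K^*$; the $T$-principal part $\partial_T$ of $\partial$ (with respect to $\rho$) is the sum of the $\partial_e$ over the lattice points $e$ of the face of $N(\partial)$ on which $\rho$ is maximal. Fix a closed embedding $X\hookrightarrow\mathbb A^r$. Let $\Sigma_s\subset\operatorname{Aut}(X)$ be the set of automorphisms $\alpha$ such that the components of $\alpha$ and $\alpha^{-1}$ are regular functions of degree at most $s$ (restrictions of polynomials of degree at most $s$), with the Zariski topology given by the components of $\alpha$ and $\alpha^{-1}$. For $F\subset\operatorname{Aut}(X)$ put $\overline F=\bigcup_s\overline{F\cap\Sigma_s}$, where $\overline{F\cap\Sigma_s}$ is the Zariski closure in $\Sigma_s$. Then the following hold. (1) Let $G\subset\operatorname{Aut}(X)$ be a subgroup normalized by a one-parameter subgroup $T=R_\rho$ of $\mathbb T$, and let $\partial\neq0$ be a locally nilpotent derivation of $A$ with $\exp(\mathbb K\partial)\subset G$. Then $\partial_T$ is a nonzero locally nilpotent derivation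 and the $\mathbb G_a$-subgroup $\exp(\mathbb K\partial_T)$ is contained in $\overline G$. (2) Let $G\subset\operatorname{Aut}(X)$ be a subgroup normalized by $\mathbb T$, and let $\partial\neq0$ be a locally nilpotent derivation of $A$ with $\exp(\mathbb K\partial)\subset G$. Then every vertex $e$ of $N(\partial)$ is a Demazure root (belonging to some $\rho\in\Xi$), and $H_e\subset\overline G$. (3) Let $\rho_1\ne\rho_2$ be in $\Xi$, let $e_i\in\mathcal S_{\rho_i}\cap M$, $i=1,2$, and let $\delta=\langle\rho_1,e_2\rangle+1$. Then $e_2+\delta e_1\in\mathcal S_{\rho_1}$ if and only if $\langle\rho_2,e_1\rangle\ge1$, and in this case $$H_{e_2+\delta e_1}\subset\overline{\langle H_{e_1},H_{e_2}\rangle}.$$ -/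

import Mathlib

open scoped TensorProduct

set_option linter.unusedSectionVars false

noncomputable section

namespace ToricRoots

section Exp
variable {K A : Type*} [Field K] [CommRing A] [Algebra K A]

def IsLocallyNilpotent (D : Derivation K A A) : Prop := ∀ a : A, ∃ n : ℕ, D^[n] a = 0

def divPow (D : Derivation K A A) (n : ℕ) (a : A) : A := ((n.factorial : K)⁻¹) • D^[n] a

theorem derivIter_add (D : Derivation K A A) (n : ℕ) (a b : A) :
    D^[n] (a + b) = D^[n] a + D^[n] b := by
  induction n with
  | zero => rfl
  | succ n ih => simp [Function.iterate_succ_apply', ih]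

theorem derivIter_smul (D : Derivation K A A) (n : ℕ) (c : K) (a : A) :
    D^[n] (c • a) = c • D^[n] a := by
  induction n with
  | zero => rfl
  | succ n ih => simp [Function.iterate_succ_apply', ih]

theorem divPow_zero (D : Derivation K A A) (a : A) : divPow D 0 a = a := by
  simp [divPow]

theorem derivIter_mul (D : Derivation K A A) (n : ℕ) (a b : A) :
    D^[n] (a * b) =
      ∑ p ∈ Finset.HasAntidiagonal.antidiagonal n, n.choose p.1 • (D^[p.1] a * D^[p.2] b) := by
  induction n with
  | zero => simp
  | succ n ih =>
    rw [Finset.sum_antidiagonal_choose_succ_nsmul (fun i j => D^[i] a * D^[j] b) n]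
    simp only [Function.iterate_succ_apply', ih, map_sum, map_nsmul, Derivation.leibniz,
      smul_add, Finset.sum_add_distrib, smul_eq_mul]
    congr 1
    refine Finset.sum_congr rfl fun p hp => ?_
    rw [mul_comm, Nat.choose_symm_of_eq_add (Finset.HasAntidiagonal.mem_antidiagonal.mp hp).symm]

theorem divPow_mul [CharZero K] (D : Derivation K A A) (n : ℕ) (a b : A) :
    divPow D n (a * b) = ∑ p ∈ Finset.HasAntidiagonal.antidiagonal n, divPow D p.1 a * divPow D p.2 b := by
  rw [divPow, derivIter_mul, Finset.smul_sum]
  refine Finset.sum_congr rfl fun p hp => ?_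
  rw [Finset.HasAntidiagonal.mem_antidiagonal] at hp
  simp only [divPow, smul_mul_smul_comm, ← Nat.cast_smul_eq_nsmul K, smul_smul]
  congr 1
  subst hp
  rw [Nat.cast_add_choose]
  have := fun k : ℕ => (Nat.cast_ne_zero (R := K)).mpr k.factorial_ne_zero
  field_simp [this]

theorem divPow_divPow [CharZero K] (D : Derivation K A A) (i j : ℕ) (a : A) :
    divPow D i (divPow D j a) = ((i + j).choose i : K) • divPow D (i + j) a := by
  simp only [divPow, derivIter_smul, smul_smul, Function.iterate_add_apply]
  congr 1
  rw [Nat.cast_add_choose]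
  have := fun k : ℕ => (Nat.cast_ne_zero (R := K)).mpr k.factorial_ne_zero
  field_simp [this]

theorem divPow_eq_zero {D : Derivation K A A} {n k : ℕ} {a : A} (h : D^[n] a = 0) (hk : n ≤ k) :
    divPow D k a = 0 := by
  obtain ⟨m, rfl⟩ := Nat.exists_eq_add_of_le' hk
  rw [divPow, Function.iterate_add_apply, h]
  have : D^[m] (0 : A) = 0 := by
    induction m with
    | zero => rfl
    | succ m ih => rw [Function.iterate_succ_apply', ih (by omega), map_zero]
  rw [this, smul_zero]

theorem sum_antidiagonal_eq (f : ℕ → ℕ → A) (n : ℕ) (h : ∀ i j, n ≤ i ∨ n ≤ j → f i j = 0) :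
    ∑ k ∈ Finset.range (2 * n), ∑ p ∈ Finset.HasAntidiagonal.antidiagonal k, f p.1 p.2 =
      ∑ i ∈ Finset.range n, ∑ j ∈ Finset.range n, f i j := by
  rw [← Finset.sum_product', Finset.sum_sigma']
  symm
  refine Finset.sum_of_injOn (fun p => ⟨p.1 + p.2, p⟩) ?_ ?_ ?_ ?_
  · intro p _ q _ h
    simp only [Sigma.mk.injEq] at h
    exact eq_of_heq h.2
  · intro p hp
    simp at hp ⊢
    omega
  · rintro ⟨k, p⟩ hp hq
    apply h
    simp only [Finset.mem_sigma, Finset.mem_range, Finset.HasAntidiagonal.mem_antidiagonal] at hp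
    by_contra hcon
    push Not at hcon
    apply hq
    refine ⟨p, by simpa using hcon, ?_⟩
    obtain ⟨_, rfl⟩ := hp
    rfl
  · intros; rfl

/-- `exp(tD)(a) = ∑ₖ tᵏ Dᵏ(a) / k!`, a finite sum when `D` is locally nilpotent. -/
def expFun (D : Derivation K A A) (t : K) (a : A) : A := ∑ᶠ k : ℕ, t ^ k • divPow D k a

theorem expFun_eq (D : Derivation K A A) (t : K) {a : A} {n : ℕ} (h : ∀ k, n ≤ k → divPow D k a = 0) :
    expFun D t a = ∑ k ∈ Finset.range n, t ^ k • divPow D k a := by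
  refine finsum_eq_sum_of_support_subset _ fun k hk => ?_
  by_contra hn
  simp only [Finset.coe_range, Set.mem_Iio, not_lt] at hn
  exact hk (by simp [h k hn])

theorem expFun_mul [CharZero K] {D : Derivation K A A} (hD : IsLocallyNilpotent D) (t : K) (a b : A) :
    expFun D t (a * b) = expFun D t a * expFun D t b := by
  obtain ⟨n₁, h₁⟩ := hD a
  obtain ⟨n₂, h₂⟩ := hD b
  set n := max n₁ n₂
  have ha : ∀ k, n ≤ k → divPow D k a = 0 := fun k hk => divPow_eq_zero h₁ (by omega)
  have hb : ∀ k, n ≤ k → divPow D k b = 0 := fun k hk => divPow_eq_zero h₂ (by omega)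
  have hab : ∀ k, 2 * n ≤ k → divPow D k (a * b) = 0 := by
    intro k hk
    rw [divPow_mul]
    refine Finset.sum_eq_zero fun p hp => ?_
    rw [Finset.HasAntidiagonal.mem_antidiagonal] at hp
    rcases le_or_gt n p.1 with h | h
    · rw [ha _ h, zero_mul]
    · rw [hb _ (by omega), mul_zero]
  rw [expFun_eq D t ha, expFun_eq D t hb, expFun_eq D t hab, Finset.sum_mul_sum,
    ← sum_antidiagonal_eq (fun i j => (t ^ i • divPow D i a) * (t ^ j • divPow D j b))]
  · refine Finset.sum_congr rfl fun k _ => ?_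
    rw [divPow_mul, Finset.smul_sum]
    refine Finset.sum_congr rfl fun p hp => ?_
    rw [Finset.HasAntidiagonal.mem_antidiagonal] at hp
    rw [smul_mul_smul_comm, ← pow_add, hp]
  · rintro i j (h | h)
    · simp [ha i h]
    · simp [hb j h]

theorem expFun_add {D : Derivation K A A} (hD : IsLocallyNilpotent D) (t : K) (a b : A) :
    expFun D t (a + b) = expFun D t a + expFun D t b := by
  obtain ⟨n₁, h₁⟩ := hD a
  obtain ⟨n₂, h₂⟩ := hD b
  have ha : ∀ k, max n₁ n₂ ≤ k → divPow D k a = 0 := fun k hk => divPow_eq_zero h₁ (by omega)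
  have hb : ∀ k, max n₁ n₂ ≤ k → divPow D k b = 0 := fun k hk => divPow_eq_zero h₂ (by omega)
  have hs : ∀ k, divPow D k (a + b) = divPow D k a + divPow D k b := fun k => by
    rw [divPow, derivIter_add, smul_add]; rfl
  rw [expFun_eq D t ha, expFun_eq D t hb, expFun_eq D t (fun k hk => by rw [hs, ha k hk, hb k hk, add_zero]),
    ← Finset.sum_add_distrib]
  exact Finset.sum_congr rfl fun k _ => by rw [hs, smul_add]

theorem expFun_algebraMap (D : Derivation K A A) (t c : K) :
    expFun D t (algebraMap K A c) = algebraMap K A c := by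
  rw [expFun_eq D t (n := 1) (fun k hk => divPow_eq_zero (n := 1) (by simp) hk)]
  simp [divPow_zero]

theorem expFun_zero (D : Derivation K A A) (a : A) : expFun D 0 a = a := by
  rw [expFun, finsum_eq_single _ 0 (fun k hk => by simp [hk])]
  simp [divPow_zero]

theorem expFun_expFun [CharZero K] {D : Derivation K A A} (hD : IsLocallyNilpotent D) (s t : K) (a : A) :
    expFun D s (expFun D t a) = expFun D (s + t) a := by
  obtain ⟨n, h₁⟩ := hD a
  have ha : ∀ k, n ≤ k → divPow D k a = 0 := fun k hk => divPow_eq_zero h₁ hk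
  have hsum : ∀ (k : ℕ) (c : ℕ → K), divPow D k (∑ j ∈ Finset.range n, c j • divPow D j a) =
      ∑ j ∈ Finset.range n, (c j * ((k + j).choose k : K)) • divPow D (k + j) a := by
    intro k c
    have hl : ∀ m : ℕ, divPow D k (∑ j ∈ Finset.range m, c j • divPow D j a) =
        ∑ j ∈ Finset.range m, (c j * ((k + j).choose k : K)) • divPow D (k + j) a := by
      intro m
      induction m with
      | zero =>
        have := derivIter_smul D k (0 : K) (0 : A)
        simp only [zero_smul] at this
        simp [divPow, this]
      | succ m ih =>
        rw [Finset.sum_range_succ, Finset.sum_range_succ, ← ih, mul_smul, ← divPow_divPow]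
        simp only [divPow, derivIter_add, derivIter_smul, smul_add, smul_smul]
        congr 2
        ring
    exact hl n
  rw [expFun_eq D t ha, expFun_eq D s (n := n) ?_, expFun_eq D (s + t) (n := 2 * n)
    (fun k hk => ha k (by omega))]
  · simp only [hsum, Finset.smul_sum, smul_smul]
    rw [← sum_antidiagonal_eq (fun k j =>
      (s ^ k * (t ^ j * ((k + j).choose k : K))) • divPow D (k + j) a)]
    · refine Finset.sum_congr rfl fun k _ => ?_
      rw [Commute.add_pow' (Commute.all s t), Finset.sum_smul]
      refine Finset.sum_congr rfl fun p hp => ?_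
      rw [Finset.HasAntidiagonal.mem_antidiagonal] at hp
      rw [hp, ← Nat.cast_smul_eq_nsmul K, smul_eq_mul]
      congr 1
      ring
    · rintro i j (h | h) <;> rw [ha _ (by omega), smul_zero]
  · intro k hk
    rw [hsum]
    exact Finset.sum_eq_zero fun j _ => by rw [ha _ (by omega), smul_zero]

/-- The automorphism `exp(tD)` of `A`. -/
def expAut [CharZero K] (D : Derivation K A A) (hD : IsLocallyNilpotent D) (t : K) : A ≃ₐ[K] A where
  toFun := expFun D t
  invFun := expFun D (-t)
  left_inv a := by rw [expFun_expFun hD, neg_add_cancel, expFun_zero]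
  right_inv a := by rw [expFun_expFun hD, add_neg_cancel, expFun_zero]
  map_mul' := expFun_mul hD t
  map_add' := expFun_add hD t
  commutes' := expFun_algebraMap D t

/-- The one-parameter subgroup `exp(K D)` -/
def expSubgroup [CharZero K] (D : Derivation K A A) (hD : IsLocallyNilpotent D) : Subgroup (A ≃ₐ[K] A) where
  carrier := Set.range (expAut D hD)
  mul_mem' := by
    rintro _ _ ⟨s, rfl⟩ ⟨t, rfl⟩
    exact ⟨s + t, AlgEquiv.ext fun a => (expFun_expFun hD s t a).symm⟩
  one_mem' := ⟨0, AlgEquiv.ext fun a => expFun_zero D a⟩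
  inv_mem' := by
    rintro _ ⟨t, rfl⟩
    exact ⟨-t, AlgEquiv.ext fun a => rfl⟩
end Exp

section Cones

theorem mem_hull_of_forall_dual {V : Type*} [AddCommGroup V] [Module ℚ V] (l : List V) (y : V)
    (h : ∀ f : Module.Dual ℚ V, (∀ v ∈ l, 0 ≤ f v) → 0 ≤ f y) :
    y ∈ PointedCone.hull ℚ {v | v ∈ l} := by
  induction hn : l.length generalizing l y with
  | zero =>
    obtain rfl := List.length_eq_zero_iff.mp hn
    have : y = 0 := by
      rw [← Module.forall_dual_apply_eq_zero_iff ℚ]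
      intro f
      have h1 := h f (by simp)
      have h2 := h (-f) (by simp)
      simp at h2
      exact le_antisymm h2 h1
    rw [this]
    exact zero_mem _
  | succ n ih =>
    obtain ⟨w, l, rfl⟩ := List.exists_cons_of_length_eq_add_one hn
    have hmono : PointedCone.hull ℚ {v | v ∈ l} ≤ PointedCone.hull ℚ {v | v ∈ w :: l} :=
      Submodule.span_mono fun v hv => List.mem_cons_of_mem _ hv
    by_cases hc : ∀ f : Module.Dual ℚ V, (∀ v ∈ l, 0 ≤ f v) → 0 ≤ f y
    · exact hmono (ih l y hc (by simpa using hn))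
    push Not at hc
    obtain ⟨f₁, hf₁, hy₁⟩ := hc
    have hw₁ : f₁ w < 0 := by
      by_contra hw
      exact absurd (h f₁ (by simpa using ⟨not_lt.mp hw, hf₁⟩)) (not_le.mpr hy₁)
    set f₀ : Module.Dual ℚ V := (-(f₁ w))⁻¹ • f₁ with hf₀
    have hpos : 0 < (-(f₁ w))⁻¹ := by simpa using hw₁
    have hf₀' : ∀ v ∈ l, 0 ≤ f₀ v := fun v hv => mul_nonneg hpos.le (hf₁ v hv)
    have hy₀ : f₀ y < 0 := mul_neg_of_pos_of_neg hpos hy₁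
    have hw₀ : f₀ w = -1 := by
      simp only [hf₀, LinearMap.smul_apply, smul_eq_mul]
      field_simp [hw₁.ne]
    have hwmem : w ∈ PointedCone.hull ℚ {v | v ∈ w :: l} :=
      PointedCone.subset_hull (by simp)
    have key := ih (l.map fun v => v + f₀ v • w) (y + f₀ y • w) (by
      intro f hf
      have := h (f + f w • f₀) (by
        intro v hv
        rcases List.mem_cons.mp hv with rfl | hv
        · simp [hw₀]
        · have := hf (v + f₀ v • w) (List.mem_map.mpr ⟨v, hv, rfl⟩)
          simp only [map_add, map_smul, smul_eq_mul] at this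
          simpa [mul_comm] using this)
      simpa [mul_comm] using this) (by simpa using hn)
    have hsub : PointedCone.hull ℚ {u | u ∈ l.map fun v => v + f₀ v • w} ≤
        PointedCone.hull ℚ {v | v ∈ w :: l} := by
      refine Submodule.span_le.mpr ?_
      rintro _ hu
      obtain ⟨v, hv, rfl⟩ := List.mem_map.mp hu
      exact add_mem (hmono (PointedCone.subset_hull hv)) (PointedCone.smul_mem _ (hf₀' v hv) hwmem)
    have : y = (y + f₀ y • w) + (-(f₀ y)) • w := by rw [neg_smul]; abel
    rw [this]
    exact add_mem (hsub key) (PointedCone.smul_mem _ (by linarith) hwmem)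

theorem exists_extremal {V : Type*} [AddCommGroup V] [Module ℚ V] (S : Finset V)
    (hS : Submodule.span ℚ (S : Set V) = ⊤) (y : V) (f : Module.Dual ℚ V)
    (hf : ∀ v ∈ S, 0 ≤ f v) (hy : f y < 0) :
    ∃ g : Module.Dual ℚ V, (∀ v ∈ S, 0 ≤ g v) ∧ g y < 0 ∧
      ∀ c : Module.Dual ℚ V, (∀ v ∈ S, g v = 0 → c v = 0) → ∃ r : ℚ, c = r • g := by
  classical
  have hex : ∃ n : ℕ, ∃ g : Module.Dual ℚ V, ((∀ v ∈ S, 0 ≤ g v) ∧ g y < 0) ∧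
      (S.filter fun v => g v ≠ 0).card = n := ⟨_, f, ⟨hf, hy⟩, rfl⟩
  obtain ⟨g, ⟨hg, hgy⟩, hgn⟩ := Nat.find_spec hex
  refine ⟨g, hg, hgy, fun c hc => ⟨c y / g y, ?_⟩⟩
  by_contra hne
  have main : ∀ c : Module.Dual ℚ V, (∀ v ∈ S, g v = 0 → c v = 0) → c y = 0 →
      ∀ v ∈ S, 0 ≤ c v := by
    intro c hc hcy v hv
    by_contra hcv
    push Not at hcv
    obtain ⟨v₀, hv₀, hmin⟩ := Finset.exists_min_image (S.filter fun v => c v < 0)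
      (fun v => g v / (-(c v))) ⟨v, by simp [hv, hcv]⟩
    simp only [Finset.mem_filter] at hv₀ hmin
    set t := g v₀ / (-(c v₀)) with ht
    have ht0 : 0 ≤ t := div_nonneg (hg _ hv₀.1) (by linarith [hv₀.2])
    have h1 : ∀ v ∈ S, 0 ≤ (g + t • c) v := by
      intro u hu
      simp only [LinearMap.add_apply, LinearMap.smul_apply, smul_eq_mul]
      rcases le_or_gt 0 (c u) with h | h
      · exact add_nonneg (hg u hu) (mul_nonneg ht0 h)
      · have := hmin u ⟨hu, h⟩
        rw [le_div_iff₀ (by linarith)] at this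
        linarith
    have h2 : (g + t • c) y < 0 := by simpa [hcy] using hgy
    refine Nat.find_min hex (m := (S.filter fun v => (g + t • c) v ≠ 0).card) ?_
      ⟨_, ⟨h1, h2⟩, rfl⟩
    rw [← hgn]
    apply Finset.card_lt_card
    refine Finset.ssubset_iff_subset_ne.mpr ⟨?_, ?_⟩
    · intro u hu
      simp only [Finset.mem_filter] at hu ⊢
      refine ⟨hu.1, fun h0 => hu.2 ?_⟩
      simp [h0, hc u hu.1 h0]
    · intro heq
      have hmem : v₀ ∈ S.filter fun v => g v ≠ 0 := by
        simp only [Finset.mem_filter]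
        exact ⟨hv₀.1, fun h0 => hv₀.2.ne (hc _ hv₀.1 h0)⟩
      rw [← heq] at hmem
      simp only [Finset.mem_filter] at hmem
      apply hmem.2
      have := hv₀.2.ne
      simp only [LinearMap.add_apply, LinearMap.smul_apply, smul_eq_mul, ht]
      field_simp
      ring
  set c' := c - (c y / g y) • g with hc'
  have hcy' : c' y = 0 := by
    simp only [hc', LinearMap.sub_apply, LinearMap.smul_apply, smul_eq_mul]
    field_simp [hgy.ne]
    ring
  have hz : ∀ v ∈ S, g v = 0 → c' v = 0 := fun v hv h0 => by simp [hc', hc v hv h0, h0]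
  have hp := main c' hz hcy'
  have hm := main (-c') (fun v hv h0 => by simp [hz v hv h0]) (by simp [hcy'])
  apply hne
  rw [← sub_eq_zero, ← hc']
  refine LinearMap.ext_on hS fun v hv => ?_
  have := hm v hv
  simp at this
  exact le_antisymm this (hp v hv)

end Cones

section Lattice

variable (M : Type*) [AddCommGroup M]

/-- The rational vector space `M_ℚ = M ⊗ ℚ` of a lattice `M`. -/
abbrev RatSpace : Type _ := ℚ ⊗[ℤ] M

variable {M}

/-- The natural map `M → M_ℚ`, injective for a lattice `M`. -/
def toRat (m : M) : RatSpace M := (1 : ℚ) ⊗ₜ[ℤ] m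

/-- The `ℚ`-linear extension to `M_ℚ` of a linear form in `N = Hom(M, ℤ)`. -/
def extendRat (ρ : Module.Dual ℤ M) : Module.Dual ℚ (RatSpace M) :=
  LinearMap.liftBaseChange ℚ ((Algebra.linearMap ℤ ℚ).comp ρ)

theorem toRat_zero : toRat (0 : M) = 0 := TensorProduct.tmul_zero _ _

theorem toRat_add (m m' : M) : toRat (m + m') = toRat m + toRat m' := TensorProduct.tmul_add _ _ _

theorem extendRat_toRat (ρ : Module.Dual ℤ M) (m : M) : extendRat ρ (toRat m) = (ρ m : ℚ) := by
  simp [extendRat, toRat]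

variable (M) in
/-- The weight cone `σ^∨ ⊆ M_ℚ` of a toric affine variety without torus factor: a rational
(finitely generated) convex cone, with nonempty interior (it spans `M_ℚ`), and pointed
(it contains no line). -/
structure WeightCone where
  cone : PointedCone ℚ (RatSpace M)
  fg : cone.FG
  span_eq_top : Submodule.span ℚ (cone : Set (RatSpace M)) = ⊤
  pointed : ∀ x ∈ cone, -x ∈ cone → x = 0

/-- The dual cone `σ ⊆ N_ℚ` of the weight cone; `N_ℚ` is realised as the dual of `M_ℚ`. -/
def WeightCone.dualCone (σ : WeightCone M) : PointedCone ℚ (Module.Dual ℚ (RatSpace M)) :=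
  PointedCone.dual (Module.Dual.eval ℚ (RatSpace M)) (σ.cone : Set (RatSpace M))

/-- The monoid `σ^∨ ∩ M`. -/
def WeightCone.monoid (σ : WeightCone M) : AddSubmonoid M where
  carrier := {m | toRat m ∈ σ.cone}
  zero_mem' := by
    change toRat 0 ∈ σ.cone
    rw [toRat_zero]
    exact σ.cone.zero_mem
  add_mem' {m m'} hm hm' := by
    change toRat (m + m') ∈ σ.cone
    rw [toRat_add]
    exact σ.cone.add_mem (x := toRat m) hm hm'

/-- A primitive lattice vector of `N`: nonzero and not a proper integer multiple. -/
def IsPrimitive (ρ : Module.Dual ℤ M) : Prop :=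
  ∀ (k : ℤ) (ρ' : Module.Dual ℤ M), ρ = k • ρ' → IsUnit k

/-- `ρ ∈ N` is a ray generator of `σ`: a primitive lattice vector which spans an extremal ray. -/
structure IsRayGenerator (σ : WeightCone M) (ρ : Module.Dual ℤ M) : Prop where
  primitive : IsPrimitive ρ
  mem : extendRat ρ ∈ σ.dualCone
  extremal : ∀ x ∈ σ.dualCone, ∀ y ∈ σ.dualCone, x + y = extendRat ρ →
    ∃ c : ℚ, 0 ≤ c ∧ x = c • extendRat ρ

/-- `e ∈ M` is a Demazure root belonging to the ray generator `ρ` of `σ`, that is, a lattice point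
of the Demazure facet of `ρ`. -/
structure IsDemazureRoot (σ : WeightCone M) (ρ : Module.Dual ℤ M) (e : M) : Prop where
  ray : IsRayGenerator σ ρ
  apply_self : ρ e = -1
  nonneg : ∀ ρ' : Module.Dual ℤ M, IsRayGenerator σ ρ' → ρ' ≠ ρ → 0 ≤ ρ' e

theorem IsRayGenerator.nonneg {σ : WeightCone M} {ρ : Module.Dual ℤ M} (h : IsRayGenerator σ ρ)
    {m : M} (hm : m ∈ σ.monoid) : 0 ≤ ρ m := by
  have : (0 : ℚ) ≤ extendRat ρ (toRat m) := h.mem hm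
  rw [extendRat_toRat] at this
  exact_mod_cast this

theorem exists_primitive [Module.Free ℤ M] [Module.Finite ℤ M]
    (g : Module.Dual ℚ (RatSpace M)) (hg : g ≠ 0) :
    ∃ ρ : Module.Dual ℤ M, IsPrimitive ρ ∧ ∃ r : ℚ, 0 < r ∧ extendRat ρ = r • g := by
  classical
  let b := Module.Free.chooseBasis ℤ M
  have hext : ∀ f f' : Module.Dual ℚ (RatSpace M), (∀ i, f (toRat (b i)) = f' (toRat (b i))) →
      f = f' := fun f f' h => (b.baseChange ℚ).ext fun i => by
    simpa [Module.Basis.baseChange_apply, toRat] using h i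
  obtain ⟨d, hd⟩ := IsLocalization.exist_integer_multiples_of_finite (nonZeroDivisors ℤ)
    fun i => g (toRat (b i))
  choose z hz using hd
  have hd0 : (d : ℤ) ≠ 0 := nonZeroDivisors.ne_zero d.2
  have hρ₀ : extendRat (b.constr ℤ fun i => (d : ℤ) * z i) = (((d : ℤ) * (d : ℤ) : ℤ) : ℚ) • g := by
    refine hext _ _ fun i => ?_
    have := hz i
    simp only [Algebra.smul_def, eq_intCast] at this
    simp only [extendRat_toRat, Module.Basis.constr_basis, LinearMap.smul_apply, smul_eq_mul]
    push_cast
    rw [this]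
    ring
  have hr₀ : (0 : ℚ) < (((d : ℤ) * (d : ℤ) : ℤ) : ℚ) := by
    exact_mod_cast mul_self_pos.mpr hd0
  obtain ⟨i, hi⟩ : ∃ i, g (toRat (b i)) ≠ 0 := by
    by_contra h
    push Not at h
    exact hg (hext _ _ fun i => by simp [h i])
  have hex : ∃ n : ℕ, ∃ ρ : Module.Dual ℤ M, (∃ r : ℚ, 0 < r ∧ extendRat ρ = r • g) ∧
      (ρ (b i)).natAbs = n := ⟨_, _, ⟨_, hr₀, hρ₀⟩, rfl⟩
  obtain ⟨ρ, ⟨r, hr, hρ⟩, hn⟩ := Nat.find_spec hex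
  refine ⟨ρ, fun k ρ' hk => ?_, r, hr, hρ⟩
  have hρi : ρ (b i) ≠ 0 := by
    intro h0
    have := extendRat_toRat ρ (b i)
    rw [hρ, h0] at this
    simp only [LinearMap.smul_apply, smul_eq_mul, Int.cast_zero, mul_eq_zero] at this
    exact this.elim hr.ne' hi
  have hk0 : k ≠ 0 := by
    rintro rfl
    exact hρi (by simp [hk])
  have hs : ∃ u : ℤ, (u = 1 ∨ u = -1) ∧ 0 < u * k := by
    rcases lt_or_gt_of_ne hk0 with h | h
    · exact ⟨-1, Or.inr rfl, by linarith⟩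
    · exact ⟨1, Or.inl rfl, by linarith⟩
  obtain ⟨u, hu, huk⟩ := hs
  have huu : u * u = 1 := by rcases hu with rfl | rfl <;> rfl
  have hle : Nat.find hex ≤ ((u • ρ') (b i)).natAbs := by
    refine Nat.find_min' hex ⟨u • ρ', ⟨r / ((u * k : ℤ) : ℚ), div_pos hr (by exact_mod_cast huk), ?_⟩,
      rfl⟩
    refine hext _ _ fun j => ?_
    have h1 := extendRat_toRat ρ (b j)
    rw [hρ, hk] at h1
    have h2 : ((u * k : ℤ) : ℚ) ≠ 0 := by exact_mod_cast huk.ne'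
    simp only [extendRat_toRat, LinearMap.smul_apply, smul_eq_mul] at h1 ⊢
    rw [div_mul_eq_mul_div, h1, eq_div_iff h2]
    push_cast
    have : (u : ℚ) * u = 1 := by exact_mod_cast huu
    linear_combination (ρ' (b j) * k : ℚ) * this
  rw [← hn, hk] at hle
  have hu1 : u.natAbs = 1 := by rcases hu with rfl | rfl <;> rfl
  simp only [LinearMap.smul_apply, smul_eq_mul, Int.natAbs_mul, hu1, one_mul] at hle
  have hρ'i : 0 < (ρ' (b i)).natAbs := by
    rw [Int.natAbs_pos]
    intro h0
    exact hρi (by simp [hk, h0])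
  rw [Int.isUnit_iff_natAbs_eq]
  have h1 : 1 ≤ k.natAbs := Int.natAbs_pos.mpr hk0
  have h2 : k.natAbs ≤ 1 := Nat.le_of_mul_le_mul_right (by simpa using hle) hρ'i
  omega

/-- A lattice point lies in `σ^∨` as soon as all ray generators of `σ` are nonnegative on it. -/
theorem mem_monoid_of_nonneg [Module.Free ℤ M] [Module.Finite ℤ M] (σ : WeightCone M) {m : M}
    (h : ∀ ρ, IsRayGenerator σ ρ → 0 ≤ ρ m) : m ∈ σ.monoid := by
  obtain ⟨S, hS⟩ := σ.fg
  have hSmem : ∀ v ∈ S, v ∈ σ.cone := fun v hv => hS ▸ PointedCone.subset_hull hv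
  have hdual : ∀ f : Module.Dual ℚ (RatSpace M), (∀ v ∈ S, 0 ≤ f v) → f ∈ σ.dualCone := by
    intro f hf x hx
    have hx' : x ∈ Submodule.span {c : ℚ // 0 ≤ c} (S : Set (RatSpace M)) := by rw [hS]; exact hx
    change 0 ≤ f x
    clear hx
    induction hx' using Submodule.span_induction with
    | mem x hx => exact hf x hx
    | zero => simp
    | add x y _ _ hx hy => rw [map_add]; exact add_nonneg hx hy
    | smul c x _ hx =>
      have : c • x = (c : ℚ) • x := rfl
      rw [this, map_smul, smul_eq_mul]
      exact mul_nonneg c.2 hx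
  have hspan : Submodule.span ℚ (S : Set (RatSpace M)) = ⊤ := by
    rw [eq_top_iff, ← σ.span_eq_top, Submodule.span_le, ← hS]
    exact PointedCone.hull_le_span (R := ℚ) (S : Set (RatSpace M))
  change toRat m ∈ σ.cone
  by_contra hm
  have : ¬ ∀ f : Module.Dual ℚ (RatSpace M), (∀ v ∈ S.toList, 0 ≤ f v) → 0 ≤ f (toRat m) := by
    intro hc
    have := mem_hull_of_forall_dual _ _ hc
    apply hm
    rw [← hS]
    simpa using this
  push Not at this
  obtain ⟨f, hf, hfm⟩ := this
  obtain ⟨g, hg, hgm, hgext⟩ := exists_extremal S hspan (toRat m) f (by simpa using hf) hfm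
  have hg0 : g ≠ 0 := by
    rintro rfl
    simp at hgm
  obtain ⟨ρ, hprim, r, hr, hρ⟩ := exists_primitive g hg0
  have hray : IsRayGenerator σ ρ := by
    refine ⟨hprim, ?_, ?_⟩
    · rw [hρ]
      exact PointedCone.smul_mem _ hr.le (hdual g hg)
    · intro x hx y hy hxy
      have hxS : ∀ v ∈ S, 0 ≤ x v := fun v hv => hx (hSmem v hv)
      have hyS : ∀ v ∈ S, 0 ≤ y v := fun v hv => hy (hSmem v hv)
      have hsum : ∀ v, x v + y v = r * g v := fun v => by
        rw [← LinearMap.add_apply, hxy, hρ]; rfl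
      obtain ⟨c, hc⟩ := hgext x fun v hv h0 => by
        have := hsum v
        rw [h0] at this
        linarith [hxS v hv, hyS v hv]
      refine ⟨c / r, div_nonneg ?_ hr.le, ?_⟩
      · obtain ⟨v, hv, hv0⟩ : ∃ v ∈ S, g v ≠ 0 := by
          by_contra hcon
          push Not at hcon
          exact hg0 (LinearMap.ext_on hspan fun v hv => by simpa using hcon v hv)
        have h1 := hxS v hv
        rw [hc] at h1
        exact nonneg_of_mul_nonneg_left h1 (lt_of_le_of_ne (hg v hv) hv0.symm)
      · rw [hρ, hc, smul_smul, div_mul_cancel₀ _ hr.ne']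
  have h1 := h ρ hray
  have h2 := extendRat_toRat ρ m
  rw [hρ] at h2
  have h3 : (ρ m : ℚ) < 0 := by
    rw [← h2]
    exact mul_neg_of_pos_of_neg hr hgm
  have : ρ m < 0 := by exact_mod_cast h3
  omega

theorem IsDemazureRoot.add_mem [Module.Free ℤ M] [Module.Finite ℤ M] {σ : WeightCone M}
    {ρ : Module.Dual ℤ M} {e : M} (h : IsDemazureRoot σ ρ e) {m : M} (hm : m ∈ σ.monoid)
    (hρ : ρ m ≠ 0) : m + e ∈ σ.monoid := by
  refine mem_monoid_of_nonneg σ fun ρ' hρ' => ?_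
  have h1 := hρ'.nonneg hm
  rw [map_add]
  by_cases heq : ρ' = ρ
  · subst heq
    have := h.apply_self
    omega
  · have := h.nonneg ρ' hρ' heq
    omega

end Lattice

section Toric

variable (K : Type*) [Field K] {M : Type*} [AddCommGroup M]

/-- The structure algebra `A = ⨁_{m ∈ σ^∨ ∩ M} K χ^m` of the toric affine variety of `σ^∨`. -/
abbrev CoordRing (σ : WeightCone M) : Type _ := AddMonoidAlgebra K σ.monoid

/-- The automorphism group of `X = Spec A`, as the group of `K`-algebra automorphisms of `A`. -/
abbrev AutGroup (σ : WeightCone M) : Type _ := CoordRing K σ ≃ₐ[K] CoordRing K σ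

/-- The derivations of `A` over `K`. -/
abbrev Der (σ : WeightCone M) : Type _ := Derivation K (CoordRing K σ) (CoordRing K σ)

variable {K} {σ : WeightCone M}

/-- The character `χ^m`. -/
def chi (m : σ.monoid) : CoordRing K σ := AddMonoidAlgebra.single m 1

theorem chi_add (m m' : σ.monoid) : (chi (m + m') : CoordRing K σ) = chi m * chi m' := by
  simp [chi, AddMonoidAlgebra.single_mul_single]

theorem chi_basis (m : σ.monoid) :
    AddMonoidAlgebra.basis σ.monoid K m = (chi m : CoordRing K σ) := rfl

/-- The linear endomorphism of `A` with prescribed values on the characters. -/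
def linearOfChi (v : σ.monoid → CoordRing K σ) : CoordRing K σ →ₗ[K] CoordRing K σ :=
  (AddMonoidAlgebra.basis σ.monoid K).constr K v

theorem linearOfChi_chi (v : σ.monoid → CoordRing K σ) (m : σ.monoid) :
    linearOfChi v (chi m) = v m := by
  rw [linearOfChi, ← chi_basis, Module.Basis.constr_basis]

theorem single_eq_smul_chi (m : σ.monoid) (c : K) :
    (AddMonoidAlgebra.single m c : CoordRing K σ) = c • chi m := by simp [chi]

theorem linearOfChi_mul (v : σ.monoid → CoordRing K σ)
    (hv : ∀ m m', v (m + m') = chi m * v m' + chi m' * v m) (a b : CoordRing K σ) :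
    linearOfChi v (a * b) = a • linearOfChi v b + b • linearOfChi v a := by
  simp only [smul_eq_mul]
  induction a using AddMonoidAlgebra.induction_linear with
  | zero => simp only [zero_mul, map_zero, mul_zero, add_zero]
  | add a a' h h' => rw [add_mul, map_add, h, h', map_add, add_mul, mul_add]; abel
  | single m c =>
    induction b using AddMonoidAlgebra.induction_linear with
    | zero => simp only [zero_mul, map_zero, mul_zero, add_zero]
    | add b b' h h' => rw [mul_add, map_add, h, h', map_add, add_mul, mul_add]; abel
    | single m' c' =>
      simp only [single_eq_smul_chi, smul_mul_smul_comm, map_smul]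
      rw [← chi_add, linearOfChi_chi, linearOfChi_chi, linearOfChi_chi, hv, smul_add,
        mul_comm c]

/-- The derivation of `A` with prescribed values on the characters. -/
def derivationOfChi (v : σ.monoid → CoordRing K σ)
    (hv : ∀ m m', v (m + m') = chi m * v m' + chi m' * v m) :
    Derivation K (CoordRing K σ) (CoordRing K σ) :=
  Derivation.mk' (linearOfChi v) (linearOfChi_mul v hv)

theorem derivationOfChi_chi (v : σ.monoid → CoordRing K σ)
    (hv : ∀ m m', v (m + m') = chi m * v m' + chi m' * v m) (m : σ.monoid) :
    derivationOfChi v hv (chi m) = v m := linearOfChi_chi v m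

/-- The linear projection of `A` to the span of the characters `χ^q` with `q - m ∈ E`. -/
def degreeProj (E : Set M) (m : M) : CoordRing K σ →ₗ[K] CoordRing K σ :=
  open Classical in linearOfChi fun q => if (q : M) - m ∈ E then chi q else 0

theorem degreeProj_mul (E : Set M) (m m' : σ.monoid) (a : CoordRing K σ) :
    degreeProj E ((m : M) + m') (chi m * a) = chi m * degreeProj E m' a := by
  classical
  have : degreeProj E ((m : M) + m') ∘ₗ LinearMap.mulLeft K (chi m) =
      LinearMap.mulLeft K (chi m) ∘ₗ degreeProj (K := K) (σ := σ) E m' := by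
    refine (AddMonoidAlgebra.basis σ.monoid K).ext fun q => ?_
    simp only [chi_basis, LinearMap.comp_apply, LinearMap.mulLeft_apply]
    rw [← chi_add, degreeProj, degreeProj, linearOfChi_chi, linearOfChi_chi]
    have : ((m + q : σ.monoid) : M) - ((m : M) + m') = q - m' := by push_cast; abel
    rw [this, mul_ite, mul_zero, ← chi_add]
  exact congr($this a)

/-- For `E ⊆ M`, the sum `∂_E = ∑_{e ∈ E} ∂_e` of the homogeneous components of `∂` with degree
in `E`: if `∂ χ^m = ∑_q c_q χ^q` then `∂_E χ^m = ∑_{q - m ∈ E} c_q χ^q`. -/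
def component (D : Derivation K (CoordRing K σ) (CoordRing K σ)) (E : Set M) :
    Derivation K (CoordRing K σ) (CoordRing K σ) :=
  derivationOfChi (fun m => degreeProj E (m : M) (D (chi m))) fun m m' => by
    rw [chi_add, Derivation.leibniz, map_add, smul_eq_mul, smul_eq_mul]
    congr 1
    · exact degreeProj_mul E m m' _
    · rw [AddSubmonoid.coe_add, add_comm (m : M)]
      exact degreeProj_mul E m' m (D (chi m))

/-- The Newton polytope `N(∂) ⊆ M_ℚ`: the convex hull of the degrees `e` with `∂_e ≠ 0`. -/
def newtonPolytope (D : Derivation K (CoordRing K σ) (CoordRing K σ)) : Set (RatSpace M) :=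
  convexHull ℚ (toRat '' {e : M | component D {e} ≠ 0})

/-- The `T`-principal part `∂_T` of `∂`, where `T = R_ρ` is the one-parameter subgroup of the torus
given by `ρ ∈ N`: the sum of the components `∂_e` over the lattice points `e` of the face of `N(∂)`
on which the linear form `ρ` is maximal. -/
def principalPart (D : Derivation K (CoordRing K σ) (CoordRing K σ)) (ρ : Module.Dual ℤ M) :
    Derivation K (CoordRing K σ) (CoordRing K σ) :=
  component D {e : M | toRat e ∈ newtonPolytope D ∧
    ∀ x ∈ newtonPolytope D, extendRat ρ x ≤ extendRat ρ (toRat e)}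

/-- The algebra endomorphism `χ^m ↦ t(m) χ^m` of `A`, for `t ∈ 𝕋 = Hom(M, K^*)`. -/
def torusHom (t : Multiplicative M →* Kˣ) : CoordRing K σ →ₐ[K] CoordRing K σ :=
  AddMonoidAlgebra.lift K (CoordRing K σ) σ.monoid
    { toFun := fun m => ((t (Multiplicative.ofAdd (m.toAdd : M)) : Kˣ) : K) • chi m.toAdd
      map_one' := by
        simp only [toAdd_one, AddSubmonoid.coe_zero, ofAdd_zero, map_one, Units.val_one, one_smul]
        rfl
      map_mul' := fun m m' => by
        rw [smul_mul_smul_comm, ← chi_add, ← Units.val_mul, ← map_mul]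
        rfl }

theorem torusHom_chi (t : Multiplicative M →* Kˣ) (m : σ.monoid) :
    torusHom t (chi m) = ((t (Multiplicative.ofAdd (m : M)) : Kˣ) : K) • (chi m : CoordRing K σ) := by
  simp [torusHom, chi, AddMonoidAlgebra.lift_single]

theorem torusHom_torusHom (t t' : Multiplicative M →* Kˣ) (a : CoordRing K σ) :
    torusHom t (torusHom t' a) = torusHom (t * t') a := by
  have : (torusHom t).toLinearMap ∘ₗ (torusHom t').toLinearMap =
      (torusHom (t * t') : CoordRing K σ →ₐ[K] CoordRing K σ).toLinearMap := by
    refine (AddMonoidAlgebra.basis σ.monoid K).ext fun m => ?_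
    simp only [chi_basis, LinearMap.comp_apply, AlgHom.toLinearMap_apply, torusHom_chi, map_smul,
      smul_smul, MonoidHom.mul_apply, Units.val_mul]
    rw [mul_comm]
  exact congr($this a)

theorem torusHom_one (a : CoordRing K σ) : torusHom 1 a = a := by
  have : (torusHom 1 : CoordRing K σ →ₐ[K] CoordRing K σ).toLinearMap = LinearMap.id := by
    refine (AddMonoidAlgebra.basis σ.monoid K).ext fun m => ?_
    rw [chi_basis, AlgHom.toLinearMap_apply, torusHom_chi]
    simp only [MonoidHom.one_apply, Units.val_one, one_smul, LinearMap.id_coe, id_eq]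
  exact congr($this a)

/-- The action of the acting torus `𝕋 = Hom(M, K^*)` on `X`, as automorphisms
`χ^m ↦ t(m) χ^m` of `A`. -/
def torusAction : (Multiplicative M →* Kˣ) →* (CoordRing K σ ≃ₐ[K] CoordRing K σ) where
  toFun t :=
    { torusHom t with
      invFun := torusHom t⁻¹
      left_inv := fun a => by
        change torusHom t⁻¹ (torusHom t a) = a
        rw [torusHom_torusHom, show t⁻¹ * t = 1 by ext; simp, torusHom_one]
      right_inv := fun a => by
        change torusHom t (torusHom t⁻¹ a) = a
        rw [torusHom_torusHom, show t * t⁻¹ = 1 by ext; simp, torusHom_one] }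
  map_one' := AlgEquiv.ext fun a => torusHom_one a
  map_mul' t t' := AlgEquiv.ext fun a => (torusHom_torusHom t t' a).symm

variable (K) in
/-- The point `m ↦ s^⟨ρ, m⟩` of the torus, for `ρ ∈ N` and `s ∈ K^*`. -/
def oneParam (ρ : Module.Dual ℤ M) (s : Kˣ) : Multiplicative M →* Kˣ where
  toFun m := s ^ ρ m.toAdd
  map_one' := by simp
  map_mul' m m' := by simp [zpow_add]

variable (K σ) in
/-- The acting torus `𝕋` as a subgroup of the automorphism group of `X`. -/
def torus : Subgroup (CoordRing K σ ≃ₐ[K] CoordRing K σ) := torusAction.range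

variable (K σ) in
/-- The one-parameter subgroup `R_ρ` of the acting torus, `s . χ^m = s^⟨ρ, m⟩ χ^m`. -/
def oneParamSubgroup (ρ : Module.Dual ℤ M) : Subgroup (CoordRing K σ ≃ₐ[K] CoordRing K σ) where
  carrier := Set.range fun s : Kˣ => torusAction (oneParam K ρ s)
  mul_mem' := by
    rintro _ _ ⟨s, rfl⟩ ⟨s', rfl⟩
    refine ⟨s * s', ?_⟩
    dsimp only
    rw [← map_mul]
    congr 1
    ext m
    simp [oneParam, mul_zpow]
  one_mem' := by
    refine ⟨1, ?_⟩
    dsimp only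
    rw [← map_one torusAction]
    congr 1
    ext m
    simp [oneParam]
  inv_mem' := by
    rintro _ ⟨s, rfl⟩
    refine ⟨s⁻¹, ?_⟩
    dsimp only
    rw [← map_inv]
    congr 1
    ext m
    simp [oneParam]

variable [Module.Free ℤ M] [Module.Finite ℤ M] {ρ : Module.Dual ℤ M} {e : M}

open Classical in
variable (K) in
/-- The homogeneous derivation `∂_{ρ,e}`, `∂_{ρ,e}(χ^m) = ⟨ρ, m⟩ χ^{m+e}`, of a Demazure root `e`
belonging to the ray generator `ρ`. If `⟨ρ, m⟩ ≠ 0` then `m + e ∈ σ^∨`. -/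
def rootDerivation (h : IsDemazureRoot σ ρ e) :
    Derivation K (CoordRing K σ) (CoordRing K σ) :=
  derivationOfChi
    (fun m => if hm : ρ m ≠ 0 then (ρ m : K) • chi ⟨m + e, h.add_mem m.2 hm⟩ else 0) fun m m' => by
    have hmul : ∀ (q q' : σ.monoid) (hq' : ρ q' ≠ 0) (hqq : (q : M) + q' + e ∈ σ.monoid),
        (chi q * chi ⟨(q' : M) + e, h.add_mem q'.2 hq'⟩ : CoordRing K σ) =
          chi ⟨q + q' + e, hqq⟩ := by
      intro q q' hq' hqq
      rw [← chi_add]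
      congr 1
      ext
      simp [add_assoc]
    have h1 := h.ray.nonneg m.2
    have h2 := h.ray.nonneg m'.2
    have hadd : ρ ((m + m' : σ.monoid) : M) = ρ m + ρ m' := by simp
    by_cases hm : ρ m = 0 <;> by_cases hm' : ρ m' = 0
    · simp [hm, hm']
    · have hs : ρ ((m + m' : σ.monoid) : M) ≠ 0 := by omega
      rw [dif_pos hs, dif_pos hm', dif_neg (by simpa using hm), mul_zero, add_zero, mul_smul_comm,
        hmul m m' hm' (h.add_mem (m + m').2 hs), hadd, hm, zero_add]
      rfl
    · have hs : ρ ((m + m' : σ.monoid) : M) ≠ 0 := by omega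
      have hmem : (m' : M) + m + e ∈ σ.monoid := by
        rw [add_comm (m' : M)]; exact h.add_mem (m + m').2 hs
      rw [dif_pos hs, dif_pos hm, dif_neg (by simpa using hm'), mul_zero, zero_add, mul_smul_comm,
        hmul m' m hm hmem, hadd, hm', add_zero]
      congr 3
      simp [add_comm]
    · have hs : ρ ((m + m' : σ.monoid) : M) ≠ 0 := by omega
      have hmem : (m' : M) + m + e ∈ σ.monoid := by
        rw [add_comm (m' : M)]; exact h.add_mem (m + m').2 hs
      rw [dif_pos hs, dif_pos hm, dif_pos hm', mul_smul_comm, mul_smul_comm,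
        hmul m' m hm hmem, hmul m m' hm' (h.add_mem (m + m').2 hs), hadd]
      have : (⟨(m' : M) + m + e, hmem⟩ : σ.monoid) =
          ⟨(m : M) + m' + e, h.add_mem (m + m').2 hs⟩ := by
        ext
        simp [add_comm]
      rw [this, ← add_smul, add_comm (ρ m' : K)]
      push_cast
      rfl

theorem rootDerivation_chi_of_ne (h : IsDemazureRoot σ ρ e) (m : σ.monoid) (hm : ρ m ≠ 0) :
    rootDerivation K h (chi m) = (ρ m : K) • chi ⟨m + e, h.add_mem m.2 hm⟩ := by
  rw [rootDerivation, derivationOfChi_chi, dif_pos hm]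

theorem rootDerivation_chi_of_eq (h : IsDemazureRoot σ ρ e) (m : σ.monoid) (hm : ρ m = 0) :
    rootDerivation K h (chi m) = 0 := by
  rw [rootDerivation, derivationOfChi_chi, dif_neg (by simpa using hm)]

theorem rootDerivation_isLocallyNilpotent (h : IsDemazureRoot σ ρ e) :
    IsLocallyNilpotent (rootDerivation K h) := by
  have key : ∀ (k : ℕ) (m : σ.monoid), ρ m = k → (rootDerivation K h)^[k + 1] (chi m) = 0 := by
    intro k
    induction k with
    | zero =>
      intro m hm
      simpa using rootDerivation_chi_of_eq h m (by simpa using hm)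
    | succ k ih =>
      intro m hm
      rw [Function.iterate_succ_apply, rootDerivation_chi_of_ne h m (by omega), derivIter_smul,
        ih, smul_zero]
      have := h.apply_self
      simp only [map_add]
      push_cast at hm
      omega
  have hzero : ∀ {n k : ℕ} {a : CoordRing K σ}, (rootDerivation K h)^[n] a = 0 → n ≤ k →
      (rootDerivation K h)^[k] a = 0 := by
    intro n k a ha hk
    obtain ⟨j, rfl⟩ := Nat.exists_eq_add_of_le' hk
    rw [Function.iterate_add_apply, ha]
    have := derivIter_smul (rootDerivation K h) j (0 : K) 0
    simpa only [zero_smul] using this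
  intro a
  induction a using AddMonoidAlgebra.induction_linear with
  | zero => exact ⟨0, rfl⟩
  | add a b ha hb =>
    obtain ⟨n, hn⟩ := ha
    obtain ⟨k, hk⟩ := hb
    exact ⟨max n k, by
      rw [derivIter_add, hzero hn (le_max_left _ _), hzero hk (le_max_right _ _), add_zero]⟩
  | single m c =>
    refine ⟨(ρ m).toNat + 1, ?_⟩
    rw [single_eq_smul_chi, derivIter_smul, key _ m (Int.toNat_of_nonneg (h.ray.nonneg m.2)).symm, smul_zero]

variable (K) in
/-- The root subgroup `H_e = exp(K ∂_{ρ,e})` of a Demazure root `e` belonging to `ρ`. -/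
def rootSubgroup [CharZero K] (h : IsDemazureRoot σ ρ e) :
    Subgroup (CoordRing K σ ≃ₐ[K] CoordRing K σ) :=
  expSubgroup (rootDerivation K h) (rootDerivation_isLocallyNilpotent h)

end Toric

section Closure

variable {K A : Type*} [Field K] [CommRing A] [Algebra K A] {r : ℕ}

/-- The Zariski closure of a subset of a finite-dimensional vector space `V`; the polynomial
functions on `V` are generated by the linear forms. -/
def zariskiClosure (K : Type*) [Field K] {V : Type*} [AddCommGroup V] [Module K V] (S : Set V) :
    Set V :=
  {v | ∀ f ∈ Algebra.adjoin K (Set.range fun (l : Module.Dual K V) (x : V) => l x),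
    (∀ w ∈ S, f w = 0) → f v = 0}

/-- For an embedding of `X = Spec A` into the affine `r`-space, given by `a₁, …, a_r ∈ A`, the space
of regular functions of degree at most `s` on `X`: the restrictions to `X` of the polynomials of
degree at most `s`. -/
def degreeLE (a : Fin r → A) (s : ℕ) : Submodule K A :=
  (MvPolynomial.restrictTotalDegree (Fin r) K s).map (MvPolynomial.aeval a).toLinearMap

/-- The set `Σ_s` of the automorphisms `α` of `X` with `deg α ≤ s` and `deg α⁻¹ ≤ s`, where the
degree is the maximum of the degrees of the components. -/
def autDegreeLE (a : Fin r → A) (s : ℕ) : Set (A ≃ₐ[K] A) :=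
  {α | ∀ i, α (a i) ∈ degreeLE (K := K) a s ∧ α⁻¹ (a i) ∈ degreeLE (K := K) a s}

/-- The coordinates of `α ∈ Σ_s`: the components of `α` and of `α⁻¹`, as a point of a
finite-dimensional vector space. They embed `Σ_s` as a Zariski closed subset. -/
def autCoords (a : Fin r → A) (s : ℕ) (α : autDegreeLE (K := K) a s) :
    (Fin r → degreeLE (K := K) a s) × (Fin r → degreeLE (K := K) a s) :=
  (fun i => ⟨α.1 (a i), (α.2 i).1⟩, fun i => ⟨α.1⁻¹ (a i), (α.2 i).2⟩)

/-- The closure in the ind-group `Aut X = lim Σ_s` of a set `F` of automorphisms: the union over `s`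
of the Zariski closures of `F ∩ Σ_s` in `Σ_s`. -/
def indClosure (a : Fin r → A) (F : Set (A ≃ₐ[K] A)) : Set (A ≃ₐ[K] A) :=
  {α | ∃ (s : ℕ) (hα : α ∈ autDegreeLE a s),
    autCoords a s ⟨α, hα⟩ ∈ zariskiClosure K (autCoords a s '' {β | β.1 ∈ F})}

end Closure

end ToricRoots

end

noncomputable section

namespace ToricRoots

/-! ### Conjugating exponentials of locally nilpotent derivations. -/

section Conjugation

variable {K A : Type*} [Field K] [CommRing A] [Algebra K A]

/-! Let `T = R_ρ`, and let `d` be the largest value of `ρ` on the degrees of `∂`. Conjugation by `s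
∈ T` multiplies the component `∂_e` by `s^⟨ρ,e⟩`. After division by `s^d` and the substitution `u =
s⁻¹`, the conjugates form the family `∑ u^(d - ⟨ρ,e⟩) ∂_e`, which is polynomial in `u` and takes the
value `∂_T` at `u = 0`. For `u ≠ 0` its exponentials lie in `G`, because `T` normalizes `G`. The
nilpotency order on each element is bounded independently of `u`, so the exponentials are polynomial
in `u` as well. A polynomial function that vanishes along a polynomial curve for all `u ≠ 0`
vanishes at `u = 0`, hence `exp(K ∂_T)` lies in the closure of `G`. This is (1):
`degeneration_semiconj`, `exists_expSubgroup_subset_indClosure`, `principalPart_expSubgroup_subset`.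

For (2), a vertex `e` of the Newton polytope is the only maximum of some integral linear form on the
degrees, so the corresponding principal part is `∂_e`. By (1) it is a nonzero homogeneous locally
nilpotent derivation `χ^m ↦ Λ(m) χ^{m+e}` with `Λ` additive. Nilpotency means that the walk `m, m +
e, m + 2e, …` stops inside the monoid at a zero of `Λ`, so `Λ(m) = -k Λ(e)` with `k ∈ ℕ`. Hence `ρ =
-Λ/Λ(e)` is integral, and the monoid projects along `e` onto the facet `ρ = 0`. This forces `ρ` to
be a ray generator and `e` to be a root (`isDemazureRoot_of_add_mem`,
`HasSymbol.exists_isDemazureRoot`).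

For (3), conjugating `∂₂ = ∂_{ρ₂,e₂}` by `exp(∂₁)`, where `∂₁ = ∂_{ρ₁,e₁}`, gives `∑
ad(∂₁)^j(∂₂)/j!`, whose terms have degrees `e₂ + j e₁`. When `⟨ρ₂,e₁⟩ ≥ 1` the last nonzero term is
`j = δ`, and it is a multiple of `∂_{ρ₁,e₂+δe₁}`. It is the principal part with respect to `-ρ₁`, so
(1) applies to the group generated by the two root subgroups, which the torus normalizes. -/

theorem iterate_semiconj {D D' : Derivation K A A} (φ : A ≃ₐ[K] A) (c : K)
    (h : ∀ a, D' (φ a) = c • φ (D a)) (n : ℕ) (a : A) :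
    D'^[n] (φ a) = c ^ n • φ (D^[n] a) := by
  induction n with
  | zero => simp
  | succ n ih =>
    rw [Function.iterate_succ_apply', ih, Derivation.map_smul, h, smul_smul,
      ← Function.iterate_succ_apply' D, pow_succ]

theorem IsLocallyNilpotent.of_semiconj {D D' : Derivation K A A} (hD : IsLocallyNilpotent D)
    (φ : A ≃ₐ[K] A) (c : K) (h : ∀ a, D' (φ a) = c • φ (D a)) : IsLocallyNilpotent D' := by
  intro a
  obtain ⟨n, hn⟩ := hD (φ.symm a)
  refine ⟨n, ?_⟩
  have := iterate_semiconj φ c h n (φ.symm a)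
  rwa [hn, map_zero, smul_zero, φ.apply_symm_apply] at this

theorem expFun_semiconj {D D' : Derivation K A A} (φ : A ≃ₐ[K] A) (c : K)
    (h : ∀ a, D' (φ a) = c • φ (D a)) (t : K) (a : A) :
    expFun D' t (φ a) = φ (expFun D (c * t) a) := by
  have := φ.toAddEquiv.map_finsum (fun k : ℕ => (c * t) ^ k • divPow D k a)
  refine Eq.trans ?_ this.symm
  refine finsum_congr fun k => ?_
  change _ = φ _
  rw [divPow, iterate_semiconj φ c h, map_smul, divPow, map_smul, smul_smul, smul_smul, smul_smul]
  congr 1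
  ring

/-- The hypothesis says `D' = c φ D φ⁻¹`. The scalar `c` is carried along because torus conjugation
reproduces the derivations of interest only up to a factor, which merely rescales the parameter of
the one-parameter group. -/
theorem expAut_semiconj [CharZero K] {D D' : Derivation K A A} (hD : IsLocallyNilpotent D)
    (hD' : IsLocallyNilpotent D') (φ : A ≃ₐ[K] A) (c : K)
    (h : ∀ a, D' (φ a) = c • φ (D a)) (t : K) :
    expAut D' hD' t = φ * expAut D hD (c * t) * φ⁻¹ := by
  refine AlgEquiv.ext fun a => ?_
  have := expFun_semiconj φ c h t (φ⁻¹ a)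
  rwa [show φ (φ⁻¹ a) = a from φ.apply_symm_apply a] at this

theorem expSubgroup_le_of_semiconj [CharZero K] {D D' : Derivation K A A}
    (hD : IsLocallyNilpotent D) (hD' : IsLocallyNilpotent D') (φ : A ≃ₐ[K] A) (c : K)
    (h : ∀ a, D' (φ a) = c • φ (D a)) {G : Subgroup (A ≃ₐ[K] A)} (hG : expSubgroup D hD ≤ G)
    (hφ : φ ∈ Subgroup.normalizer (G : Set (A ≃ₐ[K] A))) : expSubgroup D' hD' ≤ G := by
  rintro _ ⟨t, rfl⟩
  rw [expAut_semiconj hD hD' φ c h]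
  exact (Subgroup.mem_normalizer_iff.mp hφ _).mp (hG ⟨_, rfl⟩)

end Conjugation

/-! ### Polynomial curves and their limits at zero. -/

section PolynomialCurves

variable (K : Type*) [Field K] {V W : Type*} [AddCommGroup V] [Module K V] [AddCommGroup W]
  [Module K W]

variable (V) in
/-- The polynomial maps from the affine line to a vector space `V`. -/
def polyCurve : Submodule K (K → V) :=
  Submodule.span K (Set.range fun p : ℕ × V => fun u : K => u ^ p.1 • p.2)

variable {K}

theorem pow_smul_mem_polyCurve (k : ℕ) (v : V) : (fun u : K => u ^ k • v) ∈ polyCurve K V :=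
  Submodule.subset_span ⟨(k, v), rfl⟩

theorem const_mem_polyCurve (v : V) : (fun _ : K => v) ∈ polyCurve K V := by
  simpa using pow_smul_mem_polyCurve (K := K) 0 v

theorem map_mem_polyCurve (l : V →ₗ[K] W) {γ : K → V} (h : γ ∈ polyCurve K V) :
    (fun u => l (γ u)) ∈ polyCurve K W := by
  have : polyCurve K V ≤ (polyCurve K W).comap (l.compLeft K) := by
    refine Submodule.span_le.mpr ?_
    rintro _ ⟨⟨k, v⟩, rfl⟩
    convert pow_smul_mem_polyCurve (K := K) k (l v) using 0
    rw [SetLike.mem_coe, Submodule.mem_comap]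
    congr! 1
    funext u
    simp
  exact this h

theorem pow_smul_curve_mem_polyCurve (j : ℕ) {γ : K → V} (h : γ ∈ polyCurve K V) :
    (fun u => u ^ j • γ u) ∈ polyCurve K V := by
  -- Pointwise multiplication by `u^j` is a linear operator on curves, so it suffices to test it on
  -- the monomial generators of the span.
  have : polyCurve K V ≤ (polyCurve K V).comap
      (LinearMap.pi fun u : K => u ^ j • LinearMap.proj (φ := fun _ : K => V) u) := by
    refine Submodule.span_le.mpr ?_
    rintro _ ⟨⟨k, v⟩, rfl⟩
    convert pow_smul_mem_polyCurve (K := K) (j + k) v using 0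
    rw [SetLike.mem_coe, Submodule.mem_comap]
    congr! 1
    funext u
    simp [smul_smul, ← pow_add]
  exact this h

theorem sum_mem_polyCurve {ι : Type*} (s : Finset ι) {γ : ι → K → V}
    (h : ∀ i ∈ s, γ i ∈ polyCurve K V) : (fun u => ∑ i ∈ s, γ i u) ∈ polyCurve K V := by
  have := (polyCurve K V).sum_mem h
  convert this using 2 with u
  simp

theorem pi_mem_polyCurve {ι : Type*} [Fintype ι] {γ : ι → K → V}
    (h : ∀ i, γ i ∈ polyCurve K V) : (fun u i => γ i u) ∈ polyCurve K (ι → V) := by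
  classical
  have := sum_mem_polyCurve Finset.univ
    fun i _ => map_mem_polyCurve (LinearMap.single K (fun _ : ι => V) i) (h i)
  convert this using 2 with u
  funext i
  simp [Finset.sum_apply]

theorem prod_mem_polyCurve {γ : K → V} {γ' : K → W} (h : γ ∈ polyCurve K V)
    (h' : γ' ∈ polyCurve K W) : (fun u => (γ u, γ' u)) ∈ polyCurve K (V × W) := by
  have := (polyCurve K (V × W)).add_mem (map_mem_polyCurve (LinearMap.inl K V W) h)
    (map_mem_polyCurve (LinearMap.inr K V W) h')
  convert this using 2 with u
  simp

theorem exists_polynomial_of_mem_polyCurve {γ : K → K} (h : γ ∈ polyCurve K K) :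
    ∃ p : Polynomial K, ∀ u, γ u = p.eval u := by
  induction h using Submodule.span_induction with
  | mem γ h =>
    obtain ⟨⟨k, v⟩, rfl⟩ := h
    exact ⟨Polynomial.C v * Polynomial.X ^ k, fun u => by simpa using mul_comm _ _⟩
  | zero => exact ⟨0, by simp⟩
  | add γ γ' _ _ h h' =>
    obtain ⟨p, hp⟩ := h
    obtain ⟨q, hq⟩ := h'
    exact ⟨p + q, by simp [hp, hq]⟩
  | smul c γ _ h =>
    obtain ⟨p, hp⟩ := h
    exact ⟨Polynomial.C c * p, by simp [hp]⟩

/-- The polynomial has infinitely many roots. This is the only form of continuity that the limit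
argument uses. -/
theorem eval_zero_eq_zero_of_forall_ne [Infinite K] (p : Polynomial K)
    (h : ∀ u, u ≠ 0 → p.eval u = 0) : p.eval 0 = 0 := by
  have : p = 0 := Polynomial.eq_zero_of_infinite_isRoot p
    ((Set.finite_singleton (0 : K)).infinite_compl.mono fun u hu => h u hu)
  simp [this]

theorem polyCurve_zero_eq_zero [Infinite K] {γ : K → V} (hγ : γ ∈ polyCurve K V)
    (h : ∀ u, u ≠ 0 → γ u = 0) : γ 0 = 0 := by
  rw [← Module.forall_dual_apply_eq_zero_iff K]
  intro l
  obtain ⟨p, hp⟩ := exists_polynomial_of_mem_polyCurve (map_mem_polyCurve l hγ)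
  rw [hp]
  exact eval_zero_eq_zero_of_forall_ne p fun u hu => by rw [← hp, h u hu, map_zero]

/-- The limit at `0` of a polynomial curve in `S` lies in the Zariski closure of `S`. -/
theorem polyCurve_zero_mem_zariskiClosure [Infinite K] {γ : K → V} (hγ : γ ∈ polyCurve K V)
    {S : Set V} (h : ∀ u, u ≠ 0 → γ u ∈ S) : γ 0 ∈ zariskiClosure K S := by
  intro f hf hS
  have : ∃ p : Polynomial K, ∀ u, f (γ u) = p.eval u := by
    clear hS
    induction hf using Algebra.adjoin_induction with
    | mem f hf =>
      obtain ⟨l, rfl⟩ := hf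
      exact exists_polynomial_of_mem_polyCurve (map_mem_polyCurve l hγ)
    | algebraMap c => exact ⟨Polynomial.C c, by simp⟩
    | add f g _ _ hf hg =>
      obtain ⟨p, hp⟩ := hf
      obtain ⟨q, hq⟩ := hg
      exact ⟨p + q, by simp [hp, hq]⟩
    | mul f g _ _ hf hg =>
      obtain ⟨p, hp⟩ := hf
      obtain ⟨q, hq⟩ := hg
      exact ⟨p * q, by simp [hp, hq]⟩
  obtain ⟨p, hp⟩ := this
  rw [hp]
  exact eval_zero_eq_zero_of_forall_ne p fun u hu => by rw [← hp, hS _ (h u hu)]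

end PolynomialCurves

/-! ### Polynomial families of automorphisms and degree bounds. -/

section Degree

variable {K A : Type*} [Field K] [CommRing A] [Algebra K A] {r : ℕ}

theorem degreeLE_mono (a : Fin r → A) {s s' : ℕ} (h : s ≤ s') :
    degreeLE (K := K) a s ≤ degreeLE a s' := by
  refine Submodule.map_mono fun p hp => ?_
  rw [MvPolynomial.mem_restrictTotalDegree] at hp ⊢
  exact hp.trans h

theorem exists_mem_degreeLE {a : Fin r → A} (ha : Algebra.adjoin K (Set.range a) = ⊤) (x : A) :
    ∃ s, x ∈ degreeLE (K := K) a s := by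
  have hx : x ∈ Algebra.adjoin K (Set.range a) := by rw [ha]; trivial
  rw [Algebra.adjoin_range_eq_range_aeval] at hx
  obtain ⟨p, hp⟩ := hx
  exact ⟨p.totalDegree, p, (MvPolynomial.mem_restrictTotalDegree _ _ _).mpr le_rfl, hp⟩

/-- A polynomial curve has finitely many coefficients, so its values have bounded degree. The bound
is stated for every `s ≥ s₀` so that several curves can be put in a common `degreeLE a s`. -/
theorem exists_polyCurve_degreeLE {a : Fin r → A} (ha : Algebra.adjoin K (Set.range a) = ⊤)
    {γ : K → A} (h : γ ∈ polyCurve K A) :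
    ∃ s₀, ∀ s, s₀ ≤ s → ∃ γ' ∈ polyCurve K (degreeLE (K := K) a s), ∀ u, (γ' u : A) = γ u := by
  induction h using Submodule.span_induction with
  | mem γ h =>
    obtain ⟨⟨k, v⟩, rfl⟩ := h
    obtain ⟨s₀, hv⟩ := exists_mem_degreeLE ha v
    exact ⟨s₀, fun s hs => ⟨_, pow_smul_mem_polyCurve k ⟨v, degreeLE_mono a hs hv⟩, fun _ => rfl⟩⟩
  | zero => exact ⟨0, fun s _ => ⟨0, zero_mem _, fun _ => rfl⟩⟩
  | add γ₁ γ₂ _ _ h₁ h₂ =>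
    obtain ⟨s₁, h₁⟩ := h₁
    obtain ⟨s₂, h₂⟩ := h₂
    refine ⟨max s₁ s₂, fun s hs => ?_⟩
    obtain ⟨γ₁', m₁, e₁⟩ := h₁ s (by omega)
    obtain ⟨γ₂', m₂, e₂⟩ := h₂ s (by omega)
    exact ⟨_, add_mem m₁ m₂, fun u => by simp [e₁, e₂]⟩
  | smul c γ _ h =>
    obtain ⟨s₀, h⟩ := h
    refine ⟨s₀, fun s hs => ?_⟩
    obtain ⟨γ', m, e⟩ := h s hs
    exact ⟨_, Submodule.smul_mem _ c m, fun u => by simp [e]⟩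

/-- A family of automorphisms whose components and the components of whose inverses depend
polynomially on a parameter `u`, and which lies in `F` for `u ≠ 0`, has its value at `0` in the
closure of `F`. -/
theorem mem_indClosure_of_polyCurve [Infinite K] {a : Fin r → A}
    (ha : Algebra.adjoin K (Set.range a) = ⊤) {F : Set (A ≃ₐ[K] A)} (α : K → A ≃ₐ[K] A)
    (h : ∀ i, (fun u => α u (a i)) ∈ polyCurve K A)
    (h' : ∀ i, (fun u => (α u)⁻¹ (a i)) ∈ polyCurve K A) (hF : ∀ u, u ≠ 0 → α u ∈ F) :
    α 0 ∈ indClosure a F := by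
  choose s hs using fun i => exists_polyCurve_degreeLE ha (h i)
  choose s' hs' using fun i => exists_polyCurve_degreeLE ha (h' i)
  -- One degree bound valid for all components of all `α u` and of their inverses, so that the whole
  -- family lies in a single `Σ_N`.
  set N := Finset.univ.sup s + Finset.univ.sup s'
  have hN : ∀ i, s i ≤ N := fun i =>
    (Finset.le_sup (f := s) (Finset.mem_univ i)).trans (Nat.le_add_right _ _)
  have hN' : ∀ i, s' i ≤ N := fun i =>
    (Finset.le_sup (f := s') (Finset.mem_univ i)).trans (Nat.le_add_left _ _)
  choose γ hγ eγ using fun i => hs i N (hN i)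
  choose γ' hγ' eγ' using fun i => hs' i N (hN' i)
  have hα : ∀ u, α u ∈ autDegreeLE a N := fun u i =>
    ⟨by rw [← eγ i u]; exact (γ i u).2, by rw [← eγ' i u]; exact (γ' i u).2⟩
  have hc : ∀ u, autCoords a N ⟨α u, hα u⟩ = (fun i => γ i u, fun i => γ' i u) := by
    intro u
    refine Prod.ext (funext fun i => Subtype.ext ?_) (funext fun i => Subtype.ext ?_)
    · exact (eγ i u).symm
    · exact (eγ' i u).symm
  refine ⟨N, hα 0, ?_⟩
  rw [hc]
  exact polyCurve_zero_mem_zariskiClosure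
    (prod_mem_polyCurve (pi_mem_polyCurve hγ) (pi_mem_polyCurve hγ'))
    fun u hu => ⟨⟨α u, hα u⟩, hF u hu, hc u⟩

end Degree

/-! ### Limits of polynomial families of locally nilpotent derivations. -/

section Degeneration

variable {K A : Type*} [Field K] [CharZero K] [CommRing A] [Algebra K A] {r : ℕ}

/-- If the derivations `D u` depend polynomially on `u`, and if `exp(K D u) ⊆ G` for `u ≠ 0`, with
the order of nilpotency on each element bounded independently of `u`, then `D 0` is locally
nilpotent and `exp(K D 0)` is contained in the closure of `G`. -/
theorem exists_expSubgroup_subset_indClosure {a : Fin r → A}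
    (ha : Algebra.adjoin K (Set.range a) = ⊤) {G : Subgroup (A ≃ₐ[K] A)} {ι : Type*} (s : Finset ι)
    (k : ι → ℕ) (E : ι → Derivation K A A) (D : K → Derivation K A A)
    (hDE : ∀ u, D u = ∑ i ∈ s, u ^ k i • E i)
    (hnil : ∀ b, ∃ n : ℕ, ∀ u, u ≠ 0 → (D u)^[n] b = 0)
    (hG : ∀ u, u ≠ 0 → ∀ hD : IsLocallyNilpotent (D u), expSubgroup (D u) hD ≤ G) :
    ∃ hD : IsLocallyNilpotent (D 0),
      (expSubgroup (D 0) hD : Set (A ≃ₐ[K] A)) ⊆ indClosure a (G : Set (A ≃ₐ[K] A)) := by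
  have hcurve : ∀ (n : ℕ) (b : A), (fun u => (D u)^[n] b) ∈ polyCurve K A := by
    intro n b
    induction n with
    | zero => exact const_mem_polyCurve b
    | succ n ih =>
      have := sum_mem_polyCurve s fun i _ => pow_smul_curve_mem_polyCurve (k i)
        (map_mem_polyCurve (E i).toLinearMap ih)
      convert this using 2 with u
      rw [Function.iterate_succ_apply']
      nth_rewrite 1 [hDE u]
      rw [← Derivation.coeFnAddMonoidHom_apply, map_sum, Finset.sum_apply]
      rfl
  -- The uniform bound on the nilpotency order passes to `u = 0`, since `(D u)^[n] b` is a
  -- polynomial curve that vanishes for `u ≠ 0`.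
  have hall : ∀ b, ∃ n : ℕ, ∀ u, (D u)^[n] b = 0 := by
    intro b
    obtain ⟨n, hn⟩ := hnil b
    refine ⟨n, fun u => ?_⟩
    by_cases hu : u = 0
    · subst hu
      exact polyCurve_zero_eq_zero (hcurve n b) hn
    · exact hn u hu
  have hLN : ∀ u, IsLocallyNilpotent (D u) := fun u b => (hall b).imp fun n hn => hn u
  refine ⟨hLN 0, ?_⟩
  -- Because `n` does not depend on `u`, the exponential is a sum of a fixed number of terms, each
  -- polynomial in `u`.
  have hexp : ∀ (t : K) (b : A), (fun u => expFun (D u) t b) ∈ polyCurve K A := by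
    intro t b
    obtain ⟨n, hn⟩ := hall b
    have := sum_mem_polyCurve (Finset.range n) fun k _ =>
      (polyCurve K A).smul_mem (t ^ k * (k.factorial : K)⁻¹) (hcurve k b)
    convert this using 2 with u
    rw [expFun_eq (D u) t (n := n) fun k hk => divPow_eq_zero (hn u) hk]
    simp [divPow, smul_smul]
  rintro _ ⟨t, rfl⟩
  exact mem_indClosure_of_polyCurve ha (fun u => expAut (D u) (hLN u) t)
    (fun i => hexp t (a i)) (fun i => hexp (-t) (a i)) fun u hu => hG u hu (hLN u) ⟨t, rfl⟩

end Degeneration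

end ToricRoots

namespace ToricRoots

/-! ### Homogeneous components, degrees and principal parts. -/

section Components

variable {K : Type*} [Field K] {M : Type*} [AddCommGroup M] {σ : WeightCone M}

theorem coeff_chi (m q : σ.monoid) [Decidable (m = q)] :
    (chi m : CoordRing K σ).coeff q = if m = q then 1 else 0 := by
  classical
  rw [chi, AddMonoidAlgebra.coeff_single, Finsupp.single_apply]

theorem linearMap_ext_chi {V : Type*} [AddCommGroup V] [Module K V] {f g : CoordRing K σ →ₗ[K] V}
    (h : ∀ m, f (chi m) = g (chi m)) : f = g :=
  (AddMonoidAlgebra.basis σ.monoid K).ext h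

theorem der_ext_chi {D D' : Der K σ} (h : ∀ m, D (chi m) = D' (chi m)) : D = D' :=
  Derivation.ext fun a => congr($(linearMap_ext_chi
    (f := (D : CoordRing K σ →ₗ[K] CoordRing K σ)) (g := D') h) a)

open Classical in
theorem coeff_degreeProj (E : Set M) (m : M) (a : CoordRing K σ) (q : σ.monoid) :
    (degreeProj E m a).coeff q = if (q : M) - m ∈ E then a.coeff q else 0 := by
  induction a using AddMonoidAlgebra.induction_linear with
  | zero => simp
  | add a b ha hb =>
    rw [map_add, AddMonoidAlgebra.coeff_add, AddMonoidAlgebra.coeff_add, Finsupp.add_apply, ha, hb,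
      Finsupp.add_apply]
    split_ifs <;> simp
  | single n c =>
    rw [single_eq_smul_chi, map_smul, degreeProj, linearOfChi_chi, AddMonoidAlgebra.coeff_smul,
      AddMonoidAlgebra.coeff_smul, Finsupp.smul_apply, Finsupp.smul_apply]
    by_cases hn : n = q
    · subst hn
      split_ifs <;> simp
    · split_ifs <;> simp [coeff_chi, hn]

theorem component_chi (D : Der K σ) (E : Set M) (m : σ.monoid) :
    component D E (chi m) = degreeProj E (m : M) (D (chi m)) := derivationOfChi_chi _ _ m

open Classical in
theorem coeff_component_chi (D : Der K σ) (E : Set M) (m q : σ.monoid) :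
    (component D E (chi m)).coeff q = if (q : M) - m ∈ E then (D (chi m)).coeff q else 0 := by
  rw [component_chi, coeff_degreeProj]

/-- The set of degrees of the nonzero homogeneous components of a derivation. -/
def degrees (D : Der K σ) : Set M := {e | component D {e} ≠ 0}

theorem sub_mem_degrees {D : Der K σ} {m q : σ.monoid} (h : (D (chi m)).coeff q ≠ 0) :
    (q : M) - m ∈ degrees D := by
  classical
  intro h0
  have := coeff_component_chi D {(q : M) - m} m q
  rw [if_pos (Set.mem_singleton _), h0] at this
  exact h this.symm

theorem exists_coeff_ne_zero {D : Der K σ} {e : M} (h : e ∈ degrees D) :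
    ∃ m q : σ.monoid, (q : M) - m = e ∧ (D (chi m)).coeff q ≠ 0 := by
  classical
  by_contra hcon
  push Not at hcon
  refine h (der_ext_chi fun m => AddMonoidAlgebra.ext (Finsupp.ext fun q => ?_))
  rw [coeff_component_chi]
  split_ifs with hq
  · exact hcon m q hq
  · rfl

/-- Only the degrees of `D` that lie in `E` contribute. Sets defined through the Newton polytope can
therefore be replaced by simpler ones with the same trace on `degrees D`. -/
theorem component_congr (D : Der K σ) {E E' : Set M} (h : ∀ e ∈ degrees D, e ∈ E ↔ e ∈ E') :
    component D E = component D E' := by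
  classical
  refine der_ext_chi fun m => AddMonoidAlgebra.ext (Finsupp.ext fun q => ?_)
  rw [coeff_component_chi, coeff_component_chi]
  by_cases h0 : (D (chi m)).coeff q = 0
  · simp [h0]
  · simp only [h _ (sub_mem_degrees h0)]

theorem degrees_nonempty {D : Der K σ} (hD : D ≠ 0) : (degrees D).Nonempty := by
  by_contra hcon
  rw [Set.not_nonempty_iff_eq_empty] at hcon
  refine hD (der_ext_chi fun m => AddMonoidAlgebra.ext (Finsupp.ext fun q => ?_))
  by_contra h0
  have := sub_mem_degrees h0
  rw [hcon] at this
  exact this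

/-- A derivation is determined by its values on generators. The characters in the supports of the `a
i` form a finite generating set, and each of their images under `D` has finite support. -/
theorem degrees_finite {r : ℕ} {a : Fin r → CoordRing K σ}
    (ha : Algebra.adjoin K (Set.range a) = ⊤) (D : Der K σ) : (degrees D).Finite := by
  classical
  set F : Finset σ.monoid := Finset.univ.biUnion fun i => (a i).coeff.support
  have hF : Algebra.adjoin K (chi '' (F : Set σ.monoid)) = (⊤ : Subalgebra K (CoordRing K σ)) := by
    rw [eq_top_iff, ← ha, Algebra.adjoin_le_iff]
    rintro _ ⟨i, rfl⟩
    have : a i = ∑ m ∈ (a i).coeff.support, (a i).coeff m • chi m := by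
      conv_lhs => rw [← (AddMonoidAlgebra.basis σ.monoid K).linearCombination_repr (a i)]
      rw [Finsupp.linearCombination_apply, Finsupp.sum]
      rfl
    rw [this]
    refine Subalgebra.sum_mem _ fun m hm => Subalgebra.smul_mem _ (Algebra.subset_adjoin
      (Set.mem_image_of_mem _ (Finset.mem_coe.mpr ?_))) _
    exact Finset.mem_biUnion.mpr ⟨i, Finset.mem_univ i, hm⟩
  refine (F.biUnion fun m => (D (chi m)).coeff.support.image
    fun q : σ.monoid => (q : M) - m).finite_toSet.subset ?_
  intro e he
  by_contra hcon
  refine he (Derivation.ext_of_adjoin_eq_top _ hF ?_)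
  rintro _ ⟨m, hm, rfl⟩
  refine AddMonoidAlgebra.ext (Finsupp.ext fun q => ?_)
  rw [coeff_component_chi]
  split_ifs with hq
  · by_contra h0
    refine hcon ?_
    exact Finset.mem_coe.mpr (Finset.mem_biUnion.mpr ⟨m, hm, Finset.mem_image.mpr
      ⟨q, Finsupp.mem_support_iff.mpr h0, hq⟩⟩)
  · rfl

theorem toRat_mem_newtonPolytope {D : Der K σ} {e : M} (he : e ∈ degrees D) :
    toRat e ∈ newtonPolytope D := subset_convexHull ℚ _ ⟨e, he, rfl⟩

/-- A linear form has the same maximum on a convex hull as on the generating set. Lattice points of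
the face that are not degrees of `D` contribute nothing. -/
theorem principalPart_eq_component {D : Der K σ} {ρ : Module.Dual ℤ M} {e₀ : M}
    (h₀ : e₀ ∈ degrees D) (h : ∀ e ∈ degrees D, ρ e ≤ ρ e₀) :
    principalPart D ρ = component D {e | ρ e = ρ e₀} := by
  refine component_congr D fun e he => ⟨fun hmax => le_antisymm (h e he) ?_, fun heq =>
    ⟨toRat_mem_newtonPolytope he, fun x hx => ?_⟩⟩
  · have := hmax.2 _ (toRat_mem_newtonPolytope h₀)
    rw [extendRat_toRat, extendRat_toRat] at this
    exact_mod_cast this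
  · have hsub : newtonPolytope D ⊆ {x | extendRat ρ x ≤ extendRat ρ (toRat e)} := by
      refine convexHull_min ?_ (convex_halfSpace_le (extendRat ρ).isLinear _)
      rintro _ ⟨e', he', rfl⟩
      rw [Set.mem_ofPred_eq, extendRat_toRat, extendRat_toRat]
      have := h e' he'
      rw [← (heq : ρ e = ρ e₀)] at this
      exact_mod_cast this
    exact hsub hx

theorem principalPart_eq_component_singleton {D : Der K σ} {ρ : Module.Dual ℤ M} {e₀ : M}
    (h₀ : e₀ ∈ degrees D) (h : ∀ e ∈ degrees D, e ≠ e₀ → ρ e < ρ e₀) :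
    principalPart D ρ = component D {e₀} := by
  rw [principalPart_eq_component h₀ fun e he => ?_]
  · refine component_congr D fun e he => ⟨fun heq => ?_, fun heq => congrArg ρ heq⟩
    by_contra hne
    exact (h e he hne).ne heq
  · rcases eq_or_ne e e₀ with rfl | hne
    · exact le_rfl
    · exact (h e he hne).le

theorem coeff_torusHom (t : Multiplicative M →* Kˣ) (a : CoordRing K σ) (q : σ.monoid) :
    (torusHom t a).coeff q = (t (Multiplicative.ofAdd (q : M)) : K) * a.coeff q := by
  classical
  induction a using AddMonoidAlgebra.induction_linear with
  | zero => simp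
  | add a b ha hb =>
    rw [map_add, AddMonoidAlgebra.coeff_add, AddMonoidAlgebra.coeff_add, Finsupp.add_apply, ha, hb,
      Finsupp.add_apply, mul_add]
  | single n c =>
    rw [single_eq_smul_chi, map_smul, torusHom_chi, AddMonoidAlgebra.coeff_smul,
      AddMonoidAlgebra.coeff_smul, AddMonoidAlgebra.coeff_smul, Finsupp.smul_apply,
      Finsupp.smul_apply, Finsupp.smul_apply, coeff_chi]
    split_ifs with h
    · subst h
      simp [mul_comm]
    · simp

theorem iterate_eq_zero_of_le {A : Type*} [CommRing A] [Algebra K A] {D : Derivation K A A}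
    {n k : ℕ} {a : A} (ha : D^[n] a = 0) (hk : n ≤ k) : D^[k] a = 0 := by
  obtain ⟨j, rfl⟩ := Nat.exists_eq_add_of_le' hk
  rw [Function.iterate_add_apply, ha]
  simp

end Components

/-! ### Degeneration of a derivation to its principal part. -/

section PrincipalParts

variable {K : Type*} [Field K] {M : Type*} [AddCommGroup M] {σ : WeightCone M}

/-- The family of derivations `∑_j u^j ∂_j`, where `∂_j` is the homogeneous component of `∂` of
degree `d - j` for the grading given by `ρ`. -/
def degeneration (D : Der K σ) (ρ : Module.Dual ℤ M) (d : ℤ) (N : ℕ) (u : K) : Der K σ :=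
  ∑ j ∈ Finset.range N, u ^ j • component D {e | ρ e = d - j}

theorem degeneration_apply (D : Der K σ) (ρ : Module.Dual ℤ M) (d : ℤ) (N : ℕ) (u : K)
    (a : CoordRing K σ) : degeneration D ρ d N u a =
      ∑ j ∈ Finset.range N, u ^ j • component D {e | ρ e = d - j} a := by
  rw [degeneration, ← Derivation.coeFnAddMonoidHom_apply, map_sum, Finset.sum_apply]
  rfl

/-- The bounds on `ρ e` make exactly one `j < N` contribute for each degree, and they make the
truncation `toNat` harmless. -/
theorem coeff_degeneration {D : Der K σ} {ρ : Module.Dual ℤ M} {d : ℤ} {N : ℕ}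
    (h : ∀ e ∈ degrees D, d - N < ρ e ∧ ρ e ≤ d) (u : K) (m q : σ.monoid) :
    (degeneration D ρ d N u (chi m)).coeff q =
      u ^ (d - ρ ((q : M) - m)).toNat * (D (chi m)).coeff q := by
  classical
  rw [degeneration_apply, AddMonoidAlgebra.coeff_sum, Finsupp.finsetSum_apply]
  simp only [AddMonoidAlgebra.coeff_smul, Finsupp.smul_apply, coeff_component_chi, smul_eq_mul,
    Set.mem_ofPred_eq]
  by_cases h0 : (D (chi m)).coeff q = 0
  · simp [h0]
  · have := h _ (sub_mem_degrees h0)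
    rw [Finset.sum_eq_single (d - ρ ((q : M) - m)).toNat]
    · rw [if_pos (by omega)]
    · intro j _ hj
      rw [if_neg (by omega), mul_zero]
    · intro hj
      exact absurd (Finset.mem_range.mpr (by omega)) hj

/-- Conjugation by `s` turns `∑ ∂_e` into `∑ s^⟨ρ,e⟩ ∂_e = s^d ∑ (s⁻¹)^(d - ⟨ρ,e⟩) ∂_e`. The family
at parameter `s⁻¹` is thus a multiple of a torus conjugate of `D`. -/
theorem degeneration_semiconj {D : Der K σ} {ρ : Module.Dual ℤ M} {d : ℤ} {N : ℕ}
    (h : ∀ e ∈ degrees D, d - N < ρ e ∧ ρ e ≤ d) (s : Kˣ) (a : CoordRing K σ) :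
    degeneration D ρ d N ((s⁻¹ : Kˣ) : K) (torusAction (oneParam K ρ s) a) =
      ((s ^ (-d) : Kˣ) : K) • torusAction (oneParam K ρ s) (D a) := by
  have : (degeneration D ρ d N ((s⁻¹ : Kˣ) : K) : CoordRing K σ →ₗ[K] CoordRing K σ) ∘ₗ
      (torusHom (oneParam K ρ s)).toLinearMap =
      ((s ^ (-d) : Kˣ) : K) • ((torusHom (oneParam K ρ s)).toLinearMap ∘ₗ
        (D : CoordRing K σ →ₗ[K] CoordRing K σ)) := by
    refine linearMap_ext_chi fun m => AddMonoidAlgebra.ext (Finsupp.ext fun q => ?_)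
    simp only [LinearMap.comp_apply, AlgHom.toLinearMap_apply, LinearMap.smul_apply, torusHom_chi,
      map_smul, AddMonoidAlgebra.coeff_smul, Finsupp.smul_apply, coeff_torusHom, smul_eq_mul,
      Derivation.coeFn_coe, coeff_degeneration h]
    by_cases h0 : (D (chi m)).coeff q = 0
    · simp [h0]
    · have := h _ (sub_mem_degrees h0)
      rw [← mul_assoc, ← mul_assoc]
      congr 1
      have hz : (s⁻¹ : Kˣ) ^ (d - ρ ((q : M) - m)).toNat = s ^ (ρ ((q : M) - m) - d) := by
        rw [← zpow_natCast, Int.toNat_of_nonneg (by omega), inv_zpow', neg_sub]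
      rw [← Units.val_pow_eq_pow_val, hz, ← Units.val_mul, ← Units.val_mul]
      congr 1
      simp only [oneParam, MonoidHom.coe_mk, OneHom.coe_mk, toAdd_ofAdd, ← zpow_add, map_sub]
      congr 1
      ring
  exact congr($this a)

theorem degeneration_zero {D : Der K σ} {ρ : Module.Dual ℤ M} {d : ℤ} {N : ℕ}
    (h : ∀ e ∈ degrees D, d - N < ρ e ∧ ρ e ≤ d) :
    degeneration D ρ d N 0 = component D {e | ρ e = d} := by
  classical
  refine der_ext_chi fun m => AddMonoidAlgebra.ext (Finsupp.ext fun q => ?_)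
  rw [coeff_degeneration h, coeff_component_chi, Set.mem_ofPred_eq]
  by_cases h0 : (D (chi m)).coeff q = 0
  · simp [h0]
  · have := h _ (sub_mem_degrees h0)
    split_ifs with hq
    · rw [hq]
      simp
    · rw [zero_pow (by omega), zero_mul]

/-- Conjugate derivations need not have the same nilpotency order on a fixed element, but they do on
`χ^m`, which is an eigenvector of the torus: an `n` with `D^n χ^m = 0` serves every `u ≠ 0`. -/
theorem exists_iterate_degeneration_eq_zero {D : Der K σ} (hD : IsLocallyNilpotent D)
    {ρ : Module.Dual ℤ M} {d : ℤ} {N : ℕ} (h : ∀ e ∈ degrees D, d - N < ρ e ∧ ρ e ≤ d)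
    (b : CoordRing K σ) :
    ∃ n : ℕ, ∀ u : K, u ≠ 0 → (degeneration D ρ d N u)^[n] b = 0 := by
  induction b using AddMonoidAlgebra.induction_linear with
  | zero => exact ⟨0, fun _ _ => rfl⟩
  | add b b' hb hb' =>
    obtain ⟨n, hn⟩ := hb
    obtain ⟨n', hn'⟩ := hb'
    refine ⟨max n n', fun u hu => ?_⟩
    rw [derivIter_add, iterate_eq_zero_of_le (hn u hu) (le_max_left _ _),
      iterate_eq_zero_of_le (hn' u hu) (le_max_right _ _), add_zero]
  | single m c =>
    obtain ⟨n, hn⟩ := hD (chi m)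
    refine ⟨n, fun u hu => ?_⟩
    set s : Kˣ := (Units.mk0 u hu)⁻¹
    have hs : ((s⁻¹ : Kˣ) : K) = u := by simp [s]
    have key := iterate_semiconj (torusAction (oneParam K ρ s)) _ (degeneration_semiconj h s) n (chi m)
    have hchi : torusAction (oneParam K ρ s) (chi m : CoordRing K σ) =
        (oneParam K ρ s (Multiplicative.ofAdd (m : M)) : K) • chi m := torusHom_chi _ m
    rw [hn, map_zero, smul_zero, hchi, derivIter_smul, hs] at key
    rw [single_eq_smul_chi, derivIter_smul,
      (smul_eq_zero.mp key).resolve_left (Units.ne_zero _), smul_zero]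

/-- The principal part of a locally nilpotent derivation, and the one-parameter subgroup it
generates. -/
theorem principalPart_expSubgroup_subset [CharZero K] {r : ℕ} {a : Fin r → CoordRing K σ}
    (ha : Algebra.adjoin K (Set.range a) = ⊤) {G : Subgroup (AutGroup K σ)} {ρ : Module.Dual ℤ M}
    (hG : oneParamSubgroup K σ ρ ≤ Subgroup.normalizer (G : Set (AutGroup K σ))) {D : Der K σ}
    (hD : IsLocallyNilpotent D) (hne : D ≠ 0) (hDG : expSubgroup D hD ≤ G) :
    principalPart D ρ ≠ 0 ∧ ∃ hT : IsLocallyNilpotent (principalPart D ρ),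
      (expSubgroup (principalPart D ρ) hT : Set (AutGroup K σ)) ⊆
        indClosure a (G : Set (AutGroup K σ)) := by
  classical
  have hfin := degrees_finite ha D
  -- The extreme values of `ρ` on the finite set of degrees give the leading weight `ρ e₀` and the
  -- length `N` of the family.
  obtain ⟨e₀, he₀, hmax⟩ := hfin.exists_maximalFor ρ _ (degrees_nonempty hne)
  obtain ⟨e₁, he₁, hmin⟩ := hfin.exists_minimalFor ρ _ (degrees_nonempty hne)
  have hle : ∀ e ∈ degrees D, ρ e ≤ ρ e₀ := fun e he => (le_total (ρ e) (ρ e₀)).elim id (hmax he)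
  have hge : ∀ e ∈ degrees D, ρ e₁ ≤ ρ e := fun e he => (le_total (ρ e₁) (ρ e)).elim id (hmin he)
  set N := (ρ e₀ - ρ e₁).toNat + 1
  have hN : ∀ e ∈ degrees D, ρ e₀ - N < ρ e ∧ ρ e ≤ ρ e₀ := fun e he => by
    have := hle e he
    have := hge e he
    omega
  rw [principalPart_eq_component he₀ hle]
  refine ⟨fun h0 => ?_, ?_⟩
  · obtain ⟨m, q, hq, hc⟩ := exists_coeff_ne_zero he₀
    have := coeff_component_chi D {e | ρ e = ρ e₀} m q
    rw [h0, if_pos (show (q : M) - m ∈ {e | ρ e = ρ e₀} from congrArg ρ hq)] at this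
    exact hc this.symm
  · rw [← degeneration_zero hN]
    refine exists_expSubgroup_subset_indClosure ha (Finset.range N) id _ (degeneration D ρ (ρ e₀) N)
      (fun u => rfl) (exists_iterate_degeneration_eq_zero hD hN) fun u hu hD' => ?_
    -- The parameter `u` corresponds to the torus element `s = u⁻¹`.
    have key := degeneration_semiconj hN (Units.mk0 u hu)⁻¹
    rw [inv_inv, Units.val_mk0] at key
    exact expSubgroup_le_of_semiconj hD hD' _ _ key hDG (hG ⟨_, rfl⟩)

end PrincipalParts

end ToricRoots

namespace ToricRoots

/-! ### Vertices of a rational polytope are exposed. -/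

section Separation

/-- An extreme point of the convex hull of a finite set is the unique maximum on this set of some
linear form. -/
theorem exists_dual_lt_of_mem_extremePoints {V : Type*} [AddCommGroup V] [Module ℚ V] {S : Set V}
    (hS : S.Finite) {v : V} (hv : v ∈ (convexHull ℚ S).extremePoints ℚ) :
    ∃ f : Module.Dual ℚ V, ∀ w ∈ S, w ≠ v → f w < f v := by
  classical
  set T : Finset V := hS.toFinset.filter fun w => w ≠ v
  have hT : ∀ w, w ∈ T ↔ w ∈ S ∧ w ≠ v := fun w => by simp [T]
  set l : List V := T.toList.map fun w => v - w
  have hl : ∀ y, y ∈ l ↔ ∃ w, (w ∈ S ∧ w ≠ v) ∧ v - w = y := fun y => by simp [l, hT]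
  -- From `v` one can move a short way against any vector of the cone generated by the differences
  -- `v - w` without leaving the hull.
  have hhull : ∀ y ∈ PointedCone.hull ℚ {y | y ∈ l},
      ∃ ε : ℚ, 0 < ε ∧ v - ε • y ∈ convexHull ℚ S := by
    intro y hy
    induction hy using Submodule.span_induction with
    | mem y hy =>
      obtain ⟨w, hw, rfl⟩ := (hl y).mp hy
      exact ⟨1, one_pos, by simpa using subset_convexHull ℚ S hw.1⟩
    | zero => exact ⟨1, one_pos, by simpa using hv.1⟩
    | add y z _ _ hy hz =>
      obtain ⟨ε, hε, hy⟩ := hy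
      obtain ⟨η, hη, hz⟩ := hz
      refine ⟨ε * η / (ε + η), by positivity, ?_⟩
      have := (convex_convexHull ℚ S) hy hz (a := η / (ε + η)) (b := ε / (ε + η))
        (by positivity) (by positivity) (by field_simp; ring)
      convert this using 1
      match_scalars <;> field_simp
      exact add_comm _ _
    | smul c y _ hy =>
      obtain ⟨ε, hε, hy⟩ := hy
      change ∃ ε : ℚ, 0 < ε ∧ v - ε • ((c : ℚ) • y) ∈ convexHull ℚ S
      rcases c.2.eq_or_lt with h0 | hpos
      · exact ⟨1, one_pos, by simpa [← h0] using hv.1⟩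
      · refine ⟨ε / c, div_pos hε hpos, ?_⟩
        rwa [smul_smul, div_mul_cancel₀ _ hpos.ne']
  -- If no form nonnegative on the cone were positive on `v - w`, Farkas would put `w - v` in the
  -- cone. Then `v` would lie strictly between `w` and the hull point `v - ε (w - v)`, against
  -- extremality.
  have hex : ∀ w ∈ T, ∃ f : Module.Dual ℚ V, (∀ y ∈ l, 0 ≤ f y) ∧ 0 < f (v - w) := by
    intro w hw
    have hw' := (hT w).mp hw
    by_contra hcon
    push Not at hcon
    obtain ⟨ε, hε, hmem⟩ := hhull _ (mem_hull_of_forall_dual l (w - v) fun f hf => by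
      have := hcon f hf
      rw [map_sub] at this ⊢
      linarith)
    have hopen : v ∈ openSegment ℚ w (v - ε • (w - v)) := by
      refine ⟨ε / (1 + ε), 1 / (1 + ε), by positivity, by positivity, by field_simp; ring, ?_⟩
      match_scalars <;> field_simp <;> ring
    exact hw'.2 (hv.2 (subset_convexHull ℚ S hw'.1) hmem hopen)
  choose! f hf hpos using hex
  -- Every `f u` is nonnegative on each `v - w`, and `f w` is positive on it, so the sum separates
  -- all points at once.
  refine ⟨∑ w ∈ T, f w, fun w hw hne => ?_⟩
  have hwT := (hT w).mpr ⟨hw, hne⟩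
  rw [← sub_pos, ← map_sub, LinearMap.sum_apply]
  exact Finset.sum_pos' (fun u hu => hf u hu _ ((hl _).mpr ⟨w, ⟨hw, hne⟩, rfl⟩))
    ⟨w, hwT, hpos w hwT⟩

end Separation

/-! ### Lattice points of the weight cone and a criterion for roots. -/

section Lattice

variable {M : Type*} [AddCommGroup M]

theorem toRat_nsmul (n : ℕ) (m : M) : toRat (n • m) = (n : ℚ) • toRat m := by
  induction n with
  | zero => simp [toRat_zero]
  | succ n ih => rw [succ_nsmul, toRat_add, ih, Nat.cast_succ, add_smul, one_smul]

theorem exists_smul_eq_toRat (x : RatSpace M) : ∃ n : ℕ, 0 < n ∧ ∃ m : M, (n : ℚ) • x = toRat m := by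
  induction x using TensorProduct.induction_on with
  | zero => exact ⟨1, one_pos, 0, by simp [toRat_zero]⟩
  | tmul q m =>
    refine ⟨q.den, q.den_pos, q.num • m, ?_⟩
    rw [toRat, ← TensorProduct.smul_tmul, TensorProduct.smul_tmul', smul_eq_mul,
      Rat.den_mul_eq_num]
    simp
  | add x y hx hy =>
    obtain ⟨n, hn, m, h⟩ := hx
    obtain ⟨n', hn', m', h'⟩ := hy
    refine ⟨n * n', Nat.mul_pos hn hn', n' • m + n • m', ?_⟩
    rw [toRat_add, toRat_nsmul, toRat_nsmul, ← h, ← h', Nat.cast_mul]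
    module

theorem toRat_injective [Module.Free ℤ M] [Module.Finite ℤ M] :
    Function.Injective (toRat : M → RatSpace M) := by
  intro m m' h
  refine (Module.Free.chooseBasis ℤ M).ext_elem fun i => ?_
  have := congrArg (extendRat ((Module.Free.chooseBasis ℤ M).coord i)) h
  rw [extendRat_toRat, extendRat_toRat] at this
  exact_mod_cast this

theorem exists_extendRat_eq_smul [Module.Free ℤ M] [Module.Finite ℤ M]
    (f : Module.Dual ℚ (RatSpace M)) :
    ∃ ρ : Module.Dual ℤ M, ∃ r : ℚ, 0 < r ∧ extendRat ρ = r • f := by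
  by_cases hf : f = 0
  · refine ⟨0, 1, one_pos, ?_⟩
    simp [hf, extendRat]
  · obtain ⟨ρ, -, h⟩ := exists_primitive f hf
    exact ⟨ρ, h⟩

variable {σ : WeightCone M}

theorem WeightCone.exists_smul_eq_toRat_mem {x : RatSpace M} (hx : x ∈ σ.cone) :
    ∃ n : ℕ, 0 < n ∧ ∃ m ∈ σ.monoid, (n : ℚ) • x = toRat m := by
  obtain ⟨n, hn, m, h⟩ := exists_smul_eq_toRat x
  refine ⟨n, hn, m, ?_, h⟩
  change toRat m ∈ σ.cone
  rw [← h]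
  exact PointedCone.smul_mem _ (Nat.cast_nonneg n) hx

theorem WeightCone.dual_ext {f g : Module.Dual ℚ (RatSpace M)}
    (h : ∀ m ∈ σ.monoid, f (toRat m) = g (toRat m)) : f = g := by
  refine LinearMap.ext_on σ.span_eq_top fun x hx => ?_
  obtain ⟨n, hn, m, hm, e⟩ := σ.exists_smul_eq_toRat_mem hx
  have := h m hm
  rw [← e, map_smul, map_smul] at this
  exact smul_right_injective _ (Nat.cast_ne_zero.mpr hn.ne') this

theorem WeightCone.mem_dualCone {f : Module.Dual ℚ (RatSpace M)} :
    f ∈ σ.dualCone ↔ ∀ m ∈ σ.monoid, 0 ≤ f (toRat m) := by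
  refine ⟨fun hf m hm => hf hm, fun h x hx => ?_⟩
  obtain ⟨n, hn, m, hm, e⟩ := σ.exists_smul_eq_toRat_mem hx
  have := h m hm
  rw [← e, map_smul, smul_eq_mul] at this
  exact nonneg_of_mul_nonneg_right this (Nat.cast_pos.mpr hn)

/-- Since the cone spans, every vector is a difference of two cone vectors. Hence the group
generated by `σ^∨ ∩ M` is all of `M`. -/
theorem WeightCone.exists_add_mem (σ : WeightCone M) (m : M) :
    ∃ q ∈ σ.monoid, m + q ∈ σ.monoid := by
  have hdiff : ∀ x : RatSpace M, ∃ b ∈ σ.cone, x + b ∈ σ.cone := by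
    intro x
    have hx : x ∈ Submodule.span ℚ (σ.cone : Set (RatSpace M)) := by
      rw [σ.span_eq_top]
      trivial
    induction hx using Submodule.span_induction with
    | mem x hx => exact ⟨0, zero_mem _, by simpa using hx⟩
    | zero => exact ⟨0, zero_mem _, by simp⟩
    | add x y _ _ hx hy =>
      obtain ⟨b, hb, hx⟩ := hx
      obtain ⟨c, hc, hy⟩ := hy
      refine ⟨b + c, add_mem hb hc, ?_⟩
      rw [add_add_add_comm]
      exact add_mem hx hy
    | smul r x _ hx =>
      obtain ⟨b, hb, hx⟩ := hx
      rcases le_total 0 r with hr | hr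
      · refine ⟨r • b, PointedCone.smul_mem _ hr hb, ?_⟩
        rw [← smul_add]
        exact PointedCone.smul_mem _ hr hx
      · refine ⟨(-r) • (x + b), PointedCone.smul_mem _ (neg_nonneg.mpr hr) hx, ?_⟩
        have : r • x + (-r) • (x + b) = (-r) • b := by module
        rw [this]
        exact PointedCone.smul_mem _ (neg_nonneg.mpr hr) hb
  obtain ⟨b, hb, hmb⟩ := hdiff (toRat m)
  obtain ⟨n, hn, q, hq, e⟩ := σ.exists_smul_eq_toRat_mem hb
  refine ⟨q, hq, ?_⟩
  change toRat (m + q) ∈ σ.cone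
  -- Here `q = n b` clears the denominators of `b`. Exceeding `b` by `(n - 1) b` does no harm,
  -- because `n ≥ 1`.
  have : toRat (m + q) = (toRat m + b) + ((n : ℚ) - 1) • b := by
    rw [toRat_add, ← e]
    module
  rw [this]
  refine add_mem hmb (PointedCone.smul_mem _ ?_ hb)
  have : (1 : ℚ) ≤ n := by exact_mod_cast hn
  linarith

/-- An additive function on `σ^∨ ∩ M` extends to the lattice. -/
theorem WeightCone.exists_extension {B : Type*} [AddCommGroup B] (ν : M → B)
    (h : ∀ m ∈ σ.monoid, ∀ m' ∈ σ.monoid, ν (m + m') = ν m + ν m') :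
    ∃ Λ : M →+ B, ∀ m ∈ σ.monoid, Λ m = ν m := by
  choose q hq hmq using σ.exists_add_mem
  -- The difference `ν(m + p) - ν(p)` does not depend on the choice of `p`, so it defines the
  -- extension.
  have key : ∀ m p, p ∈ σ.monoid → m + p ∈ σ.monoid → ν (m + q m) - ν (q m) = ν (m + p) - ν p := by
    intro m p hp hmp
    have h1 := h _ (hmq m) _ hp
    have h2 := h _ hmp _ (hq m)
    have h3 : m + q m + p = m + p + q m := by abel
    rw [h3, h2] at h1
    rw [sub_eq_sub_iff_add_eq_add, ← h1]
  refine ⟨AddMonoidHom.mk' (fun m => ν (m + q m) - ν (q m)) fun m m' => ?_, fun m hm => ?_⟩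
  · have hs : m + m' + (q m + q m') = (m + q m) + (m' + q m') := by abel
    rw [key (m + m') (q m + q m') (add_mem (hq m) (hq m'))
      (by rw [hs]; exact add_mem (hmq m) (hmq m')), hs, h _ (hmq m) _ (hmq m'),
      h _ (hq m) _ (hq m')]
    abel
  · have := key m m hm (add_mem hm hm)
    rw [h m hm m hm, add_sub_cancel_right] at this
    exact this

/-- A criterion for Demazure roots: subtracting the multiple `-⟨ρ, m⟩` of `e` projects the monoid
`σ^∨ ∩ M` to the facet defined by `ρ`. -/
theorem isDemazureRoot_of_add_mem [Module.Free ℤ M] [Module.Finite ℤ M] {ρ : Module.Dual ℤ M}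
    {e : M} (he : ρ e = -1)
    (h : ∀ m ∈ σ.monoid, ∃ k : ℕ, ρ m = k ∧ m + k • e ∈ σ.monoid) : IsDemazureRoot σ ρ e := by
  have hmem : extendRat ρ ∈ σ.dualCone := σ.mem_dualCone.mpr fun m hm => by
    obtain ⟨k, hk, -⟩ := h m hm
    rw [extendRat_toRat, hk]
    simp
  refine ⟨⟨fun k ρ' hk => ?_, hmem, fun x hx y hy hxy => ?_⟩, he, fun ρ' hρ' hne => ?_⟩
  · refine IsUnit.of_mul_eq_one (-(ρ' e)) ?_
    rw [hk, LinearMap.smul_apply, smul_eq_mul] at he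
    linarith
  · have hx0 : ∀ m ∈ σ.monoid, x (toRat m) = -x (toRat e) * ρ m := by
      intro m hm
      obtain ⟨k, hk, hmk⟩ := h m hm
      have h1 := σ.mem_dualCone.mp hx _ hmk
      have h2 := σ.mem_dualCone.mp hy _ hmk
      have h3 := congrArg (fun f => f (toRat (m + k • e))) hxy
      simp only [LinearMap.add_apply, extendRat_toRat] at h3
      rw [map_add, map_nsmul, hk, he] at h3
      simp only [nsmul_eq_mul, mul_neg, mul_one, add_neg_cancel, Int.cast_zero] at h3
      have h4 : x (toRat (m + k • e)) = 0 := by linarith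
      rw [toRat_add, toRat_nsmul, map_add, map_smul, smul_eq_mul] at h4
      rw [hk]
      push_cast
      linarith
    refine ⟨-x (toRat e), ?_, σ.dual_ext fun m hm => ?_⟩
    -- The sign of the factor is read off at a monoid element `q` with `ρ q > 0`; it exists because
    -- `e` is a difference of monoid elements and `ρ e = -1`.
    · obtain ⟨q, hq, heq⟩ := σ.exists_add_mem e
      obtain ⟨k, hk, -⟩ := h _ heq
      rw [map_add, he] at hk
      have h1 := σ.mem_dualCone.mp hx _ hq
      rw [hx0 q hq] at h1
      have h2 : (0 : ℚ) < ρ q := by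
        have : 0 < ρ q := by omega
        exact_mod_cast this
      exact nonneg_of_mul_nonneg_left h1 h2
    · rw [hx0 m hm, LinearMap.smul_apply, extendRat_toRat, smul_eq_mul]
  -- If `ρ' e < 0`, then `ρ' = (-ρ' e) ρ + (ρ' + (ρ' e) ρ)` splits `ρ'` inside the dual cone; the
  -- second summand is nonnegative because its value at `m` is that of `ρ'` at the projection of
  -- `m`. Extremality makes `ρ'` proportional to `ρ`, and primitivity makes them equal.
  · by_contra hneg
    push Not at hneg
    have hy : (-(ρ' e) : ℚ) • extendRat ρ ∈ σ.dualCone :=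
      PointedCone.smul_mem _ (by have : (ρ' e : ℚ) < 0 := by exact_mod_cast hneg
                                 linarith) hmem
    have hx : extendRat ρ' + (ρ' e : ℚ) • extendRat ρ ∈ σ.dualCone := by
      refine σ.mem_dualCone.mpr fun m hm => ?_
      obtain ⟨k, hk, hmk⟩ := h m hm
      have := hρ'.nonneg hmk
      rw [LinearMap.add_apply, LinearMap.smul_apply, extendRat_toRat, extendRat_toRat, hk]
      rw [map_add, map_nsmul, nsmul_eq_mul] at this
      have h2 : (0 : ℚ) ≤ ((ρ' m + k * ρ' e : ℤ) : ℚ) := by exact_mod_cast this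
      push_cast at h2 ⊢
      rw [smul_eq_mul]
      linarith
    obtain ⟨c, -, hc⟩ := hρ'.extremal _ hy _ hx (by module)
    have hval : ∀ m, -(ρ' e : ℚ) * ρ m = c * ρ' m := fun m => by
      have := congrArg (fun f => f (toRat m)) hc
      simpa [extendRat_toRat] using this
    have hc1 : c = 1 := by
      have := hval e
      rw [he] at this
      have h0 : (ρ' e : ℚ) ≠ 0 := by exact_mod_cast hneg.ne
      push_cast at this
      exact mul_right_cancel₀ h0 (by linarith)
    have heq : ρ' = (-(ρ' e)) • ρ := LinearMap.ext fun m => by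
      have := hval m
      rw [hc1, one_mul] at this
      rw [LinearMap.smul_apply, smul_eq_mul]
      exact_mod_cast this.symm
    have hunit := hρ'.primitive _ _ heq
    rw [Int.isUnit_iff] at hunit
    have h1 : -(ρ' e) = 1 := by omega
    rw [h1, one_smul] at heq
    exact hne heq

end Lattice

/-! ### Homogeneous locally nilpotent derivations and vertices. -/

section Homogeneous

variable {K : Type*} [Field K] {M : Type*} [AddCommGroup M] {σ : WeightCone M}

open Classical in
variable (K σ) in
/-- The character `χ^q` if `q ∈ σ^∨`, and zero otherwise. -/
def mono (q : M) : CoordRing K σ := if h : q ∈ σ.monoid then chi ⟨q, h⟩ else 0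

theorem mono_of_mem {q : M} (h : q ∈ σ.monoid) : mono K σ q = chi ⟨q, h⟩ := dif_pos h

theorem mono_coe (m : σ.monoid) : mono K σ (m : M) = chi m := mono_of_mem m.2

theorem mono_ne_zero {q : M} (h : q ∈ σ.monoid) : mono K σ q ≠ 0 := by
  rw [mono_of_mem h]
  exact (AddMonoidAlgebra.basis σ.monoid K).ne_zero _

theorem mono_mul {q q' : M} (h : q ∈ σ.monoid) (h' : q' ∈ σ.monoid) :
    mono K σ q * mono K σ q' = mono K σ (q + q') := by
  rw [mono_of_mem h, mono_of_mem h', mono_of_mem (add_mem h h'), ← chi_add]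
  rfl

/-- The derivation `D` is homogeneous of degree `e`, `D χ^m = ν(m) χ^{m+e}`. -/
def HasSymbol (D : Der K σ) (e : M) (ν : M → K) : Prop :=
  ∀ m ∈ σ.monoid, D (mono K σ m) = ν m • mono K σ (m + e) ∧ (ν m ≠ 0 → m + e ∈ σ.monoid)

/-- The Leibniz rule gives additivity when `m + m' + e` lies in the monoid. Otherwise neither `m +
e` nor `m' + e` can lie there, and all three values vanish. -/
theorem HasSymbol.map_add {D : Der K σ} {e : M} {ν : M → K} (h : HasSymbol D e ν) {m m' : M}
    (hm : m ∈ σ.monoid) (hm' : m' ∈ σ.monoid) : ν (m + m') = ν m + ν m' := by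
  by_cases hmem : m + m' + e ∈ σ.monoid
  · have hmul : ∀ q ∈ σ.monoid, ∀ q' ∈ σ.monoid,
        ν q' • (mono K σ q * mono K σ (q' + e)) = ν q' • mono K σ (q + q' + e) := by
      intro q hq q' hq'
      by_cases h0 : ν q' = 0
      · rw [h0, zero_smul, zero_smul]
      · rw [mono_mul hq ((h q' hq').2 h0), add_assoc]
    have h1 := (h _ (add_mem hm hm')).1
    rw [← mono_mul hm hm', Derivation.leibniz, (h m hm).1, (h m' hm').1, smul_eq_mul, smul_eq_mul,
      mul_smul_comm, mul_smul_comm, hmul m hm m' hm', hmul m' hm' m hm, add_comm m' m,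
      ← add_smul] at h1
    rw [add_comm (ν m)]
    exact (smul_left_injective K (mono_ne_zero hmem) h1).symm
  · have h0 : ν (m + m') = 0 := by
      by_contra hne
      exact hmem ((h _ (add_mem hm hm')).2 hne)
    have h1 : ν m = 0 := by
      by_contra hne
      refine hmem ?_
      rw [add_right_comm]
      exact add_mem ((h m hm).2 hne) hm'
    have h2 : ν m' = 0 := by
      by_contra hne
      refine hmem ?_
      rw [add_assoc]
      exact add_mem hm ((h m' hm').2 hne)
    rw [h0, h1, h2, add_zero]

theorem HasSymbol.congr {D : Der K σ} {e : M} {ν ν' : M → K} (h : HasSymbol D e ν)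
    (hν : ∀ m ∈ σ.monoid, ν' m = ν m) : HasSymbol D e ν' := fun m hm => by
  rw [hν m hm]
  exact h m hm

theorem HasSymbol.unique {D D' : Der K σ} {e : M} {ν : M → K} (h : HasSymbol D e ν)
    (h' : HasSymbol D' e ν) : D = D' := der_ext_chi fun m => by
  rw [← mono_coe, (h m m.2).1, (h' m m.2).1]

theorem HasSymbol.smul {D : Der K σ} {e : M} {ν : M → K} (h : HasSymbol D e ν) (c : K) :
    HasSymbol (c • D) e fun m => c * ν m := fun m hm => by
  refine ⟨?_, fun h0 => (h m hm).2 (right_ne_zero_of_mul h0)⟩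
  rw [Derivation.smul_apply, (h m hm).1, smul_smul]

theorem hasSymbol_rootDerivation [Module.Free ℤ M] [Module.Finite ℤ M] {ρ : Module.Dual ℤ M} {e : M}
    (h : IsDemazureRoot σ ρ e) : HasSymbol (rootDerivation K h) e fun m => (ρ m : K) := by
  intro m hm
  refine ⟨?_, fun h0 => h.add_mem hm fun h1 => h0 (by simp [h1])⟩
  change _ = (ρ m : K) • _
  by_cases h0 : ρ m = 0
  · rw [mono_of_mem hm, rootDerivation_chi_of_eq h ⟨m, hm⟩ h0, h0, Int.cast_zero, zero_smul]
  · rw [mono_of_mem hm, rootDerivation_chi_of_ne h ⟨m, hm⟩ h0, mono_of_mem (h.add_mem hm h0)]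

open Classical in
-- The symbol is extended from the monoid to a homomorphism on `M` so that it can be evaluated at
-- `e`, which need not belong to the monoid.
theorem exists_hasSymbol_component (D : Der K σ) (e : M) :
    ∃ Λ : M →+ K, HasSymbol (component D {e}) e Λ := by
  set ν : M → K := fun m => if h : m ∈ σ.monoid ∧ m + e ∈ σ.monoid then
    (D (chi ⟨m, h.1⟩)).coeff ⟨m + e, h.2⟩ else 0 with hν
  have hsym : HasSymbol (component D {e}) e ν := by
    intro m hm
    refine ⟨?_, fun h0 => ?_⟩
    · refine AddMonoidAlgebra.ext (Finsupp.ext fun q => ?_)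
      rw [mono_of_mem hm, coeff_component_chi, AddMonoidAlgebra.coeff_smul, Finsupp.smul_apply]
      split_ifs with hq
      · have hq' : (q : M) = m + e := by
          rw [Set.mem_singleton_iff] at hq
          rw [← hq]
          simp
        have hmem : m + e ∈ σ.monoid := hq' ▸ q.2
        have hqe : q = ⟨m + e, hmem⟩ := Subtype.ext hq'
        rw [mono_of_mem hmem, hν, hqe, coeff_chi, if_pos rfl]
        simp only [dif_pos (And.intro hm hmem), smul_eq_mul, mul_one]
      · by_cases hmem : m + e ∈ σ.monoid
        · rw [mono_of_mem hmem, coeff_chi, if_neg, smul_zero]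
          rintro rfl
          simp at hq
        · simp [mono, hmem]
    · by_contra hmem
      exact h0 (dif_neg fun hc => hmem hc.2)
  obtain ⟨Λ, hΛ⟩ := WeightCone.exists_extension (σ := σ) ν fun m hm m' hm' => hsym.map_add hm hm'
  exact ⟨Λ, hsym.congr hΛ⟩

/-- One has `D^k χ^m = ν(m) ν(m+e) ⋯ ν(m+(k-1)e) χ^{m+ke}` as long as no factor vanishes, and
nilpotency forces a factor to vanish. The first zero is reached without leaving the monoid. -/
theorem HasSymbol.exists_add_nsmul_mem {D : Der K σ} {e : M} {ν : M → K} (h : HasSymbol D e ν)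
    (hD : IsLocallyNilpotent D) {m : M} (hm : m ∈ σ.monoid) :
    ∃ k : ℕ, m + k • e ∈ σ.monoid ∧ ν (m + k • e) = 0 := by
  classical
  have hiter : ∀ k : ℕ, (∀ i < k, ν (m + i • e) ≠ 0) → m + k • e ∈ σ.monoid ∧
      ∃ c : K, c ≠ 0 ∧ D^[k] (mono K σ m) = c • mono K σ (m + k • e) := by
    intro k
    induction k with
    | zero => exact fun _ => ⟨by simpa using hm, 1, one_ne_zero, by simp⟩
    | succ k ih =>
      intro hk
      obtain ⟨hmem, c, hc, hDk⟩ := ih fun i hi => hk i (by omega)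
      have hnext := h _ hmem
      rw [add_assoc, ← succ_nsmul] at hnext
      refine ⟨hnext.2 (hk k (by omega)), c * ν (m + k • e), mul_ne_zero hc (hk k (by omega)), ?_⟩
      rw [Function.iterate_succ_apply', hDk, Derivation.map_smul, hnext.1, smul_smul]
  have hex : ∃ k : ℕ, ν (m + k • e) = 0 := by
    by_contra hcon
    push Not at hcon
    obtain ⟨n, hn⟩ := hD (mono K σ m)
    obtain ⟨hmem, c, hc, hDn⟩ := hiter n fun i _ => hcon i
    rw [hDn] at hn
    exact smul_ne_zero hc (mono_ne_zero hmem) hn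
  exact ⟨Nat.find hex, (hiter _ fun i hi => Nat.find_min hex hi).1, Nat.find_spec hex⟩

/-- A nonzero homogeneous locally nilpotent derivation is a multiple of a root derivation. -/
theorem HasSymbol.exists_isDemazureRoot [CharZero K] [Module.Free ℤ M] [Module.Finite ℤ M]
    {D : Der K σ} {e : M} {Λ : M →+ K} (h : HasSymbol D e Λ) (hD : IsLocallyNilpotent D)
    (hne : D ≠ 0) :
    ∃ (ρ : Module.Dual ℤ M) (he : IsDemazureRoot σ ρ e) (c : K), c ≠ 0 ∧
      D = c • rootDerivation K he := by
  have hk : ∀ m ∈ σ.monoid, ∃ k : ℕ, m + k • e ∈ σ.monoid ∧ Λ m = k * -Λ e := by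
    intro m hm
    obtain ⟨k, hmem, h0⟩ := h.exists_add_nsmul_mem hD hm
    refine ⟨k, hmem, ?_⟩
    rw [_root_.map_add, map_nsmul, nsmul_eq_mul] at h0
    linear_combination h0
  have he0 : -Λ e ≠ 0 := by
    intro h0
    refine hne (der_ext_chi fun m => ?_)
    obtain ⟨k, -, hΛ⟩ := hk m m.2
    rw [← mono_coe, (h m m.2).1, hΛ, h0, mul_zero, zero_smul]
    rfl
  -- Integrality passes from the monoid to `M`, since every lattice point is a difference of monoid
  -- elements.
  have hz : ∀ m : M, ∃ z : ℤ, Λ m = z * -Λ e := by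
    intro m
    obtain ⟨q, hq, hmq⟩ := σ.exists_add_mem m
    obtain ⟨k, -, h1⟩ := hk _ hq
    obtain ⟨l, -, h2⟩ := hk _ hmq
    refine ⟨l - k, ?_⟩
    rw [_root_.map_add, h1] at h2
    push_cast
    linear_combination h2
  choose z hz using hz
  have hinj : ∀ i j : ℤ, (i : K) * -Λ e = j * -Λ e → i = j := fun i j hij => by
    exact_mod_cast mul_right_cancel₀ he0 hij
  -- The form `ρ = -Λ/Λ(e)`; in characteristic zero its integer values are unique, hence additive.
  set ρ : Module.Dual ℤ M := (AddMonoidHom.mk' z fun m m' => hinj _ _ (by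
    rw [← hz, _root_.map_add, hz m, hz m']
    push_cast
    ring)).toIntLinearMap with hρ
  have hρz : ∀ m, ρ m = z m := fun m => rfl
  have he : IsDemazureRoot σ ρ e := by
    refine isDemazureRoot_of_add_mem (hinj _ _ ?_) fun m hm => ?_
    · rw [hρz, ← hz]
      simp
    · obtain ⟨k, hmem, hΛ⟩ := hk m hm
      refine ⟨k, hinj _ _ ?_, hmem⟩
      rw [hρz, ← hz, hΛ]
      simp
  refine ⟨ρ, he, -Λ e, he0, h.unique (((hasSymbol_rootDerivation he).smul _).congr fun m _ => ?_)⟩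
  rw [hz, hρz, mul_comm]

theorem rootSubgroup_le_expSubgroup [CharZero K] [Module.Free ℤ M] [Module.Finite ℤ M]
    {ρ : Module.Dual ℤ M} {e : M} (h : IsDemazureRoot σ ρ e) {D : Der K σ}
    (hD : IsLocallyNilpotent D) {c : K} (hc : c ≠ 0) (hDc : D = c • rootDerivation K h) :
    rootSubgroup K h ≤ expSubgroup D hD := by
  refine expSubgroup_le_of_semiconj hD (rootDerivation_isLocallyNilpotent h) 1 c⁻¹ (fun a => ?_)
    le_rfl (one_mem _)
  rw [AlgEquiv.one_apply, AlgEquiv.one_apply, hDc, Derivation.smul_apply, smul_smul,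
    inv_mul_cancel₀ hc, one_smul]

/-- A linear form exposing the vertex, scaled to an integral `μ`, isolates the single component
`∂_e` as principal part. What remains is the classification of homogeneous locally nilpotent
derivations. -/
theorem rootSubgroup_subset_indClosure_of_vertex [CharZero K] [Module.Free ℤ M] [Module.Finite ℤ M]
    {r : ℕ} {a : Fin r → CoordRing K σ} (ha : Algebra.adjoin K (Set.range a) = ⊤)
    {G : Subgroup (AutGroup K σ)}
    (hG : torus K σ ≤ Subgroup.normalizer (G : Set (AutGroup K σ))) {D : Der K σ}
    (hD : IsLocallyNilpotent D) (hne : D ≠ 0) (hDG : expSubgroup D hD ≤ G) {v : RatSpace M}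
    (hv : v ∈ (newtonPolytope D).extremePoints ℚ) :
    ∃ e : M, toRat e = v ∧ ∃ (ρ : Module.Dual ℤ M) (he : IsDemazureRoot σ ρ e),
      (rootSubgroup K he : Set (AutGroup K σ)) ⊆ indClosure a (G : Set (AutGroup K σ)) := by
  obtain ⟨e, he, rfl⟩ := extremePoints_convexHull_subset hv
  obtain ⟨f, hf⟩ := exists_dual_lt_of_mem_extremePoints ((degrees_finite ha D).image toRat) hv
  obtain ⟨μ, r, hr, hμ⟩ := exists_extendRat_eq_smul f
  have hpp : principalPart D μ = component D {e} := by
    refine principalPart_eq_component_singleton he fun e' he' hne' => ?_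
    have h1 := hf _ ⟨e', he', rfl⟩ (toRat_injective.ne hne')
    have h2 : extendRat μ (toRat e') < extendRat μ (toRat e) := by
      rw [hμ]
      exact mul_lt_mul_of_pos_left h1 hr
    rw [extendRat_toRat, extendRat_toRat] at h2
    exact_mod_cast h2
  have hT : oneParamSubgroup K σ μ ≤ Subgroup.normalizer (G : Set (AutGroup K σ)) := by
    refine le_trans ?_ hG
    rintro _ ⟨s, rfl⟩
    exact ⟨_, rfl⟩
  obtain ⟨hne', hLN, hsub⟩ := principalPart_expSubgroup_subset ha hT hD hne hDG
  obtain ⟨Λ, hΛ⟩ := exists_hasSymbol_component D e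
  rw [← hpp] at hΛ
  obtain ⟨ρ, hroot, c, hc, hDc⟩ := hΛ.exists_isDemazureRoot hLN hne'
  exact ⟨e, rfl, ρ, hroot, fun x hx => hsub (rootSubgroup_le_expSubgroup hroot hLN hc hDc hx)⟩

end Homogeneous

end ToricRoots

namespace ToricRoots

/-! ### The exponential of the adjoint action. -/

section Adjoint

variable {K A : Type*} [Field K] [CommRing A] [Algebra K A]

/-- The iterated commutator `ad(D)^j (E)`. -/
def adIter (D E : Derivation K A A) (j : ℕ) : Derivation K A A := (fun F => ⁅D, F⁆)^[j] E

theorem adIter_zero (D E : Derivation K A A) : adIter D E 0 = E := rfl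

theorem adIter_succ (D E : Derivation K A A) (j : ℕ) : adIter D E (j + 1) = ⁅D, adIter D E j⁆ :=
  Function.iterate_succ_apply' _ _ _

theorem adIter_eq_zero_of_le {D E : Derivation K A A} {n k : ℕ} (h : adIter D E n = 0)
    (hk : n ≤ k) : adIter D E k = 0 := by
  induction k, hk using Nat.le_induction with
  | base => exact h
  | succ k _ ih => rw [adIter_succ, ih, lie_zero]

theorem apply_adIter (D E : Derivation K A A) (j : ℕ) (a : A) :
    D (adIter D E j a) = adIter D E (j + 1) a + adIter D E j (D a) := by
  rw [adIter_succ, Derivation.commutator_apply]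
  abel

/-- Left composition with `D` is `ad D` plus right composition with `D`, and these two operators
commute. The formula is the binomial theorem for their sum. -/
theorem derivIter_apply (D E : Derivation K A A) (n : ℕ) (a : A) :
    D^[n] (E a) = ∑ p ∈ Finset.HasAntidiagonal.antidiagonal n,
      n.choose p.1 • adIter D E p.1 (D^[p.2] a) := by
  induction n with
  | zero => simp [adIter_zero]
  | succ n ih =>
    rw [Finset.sum_antidiagonal_choose_succ_nsmul (fun i j => adIter D E i (D^[j] a)) n]
    simp only [Function.iterate_succ_apply', ih, map_sum, map_nsmul, apply_adIter,
      smul_add, Finset.sum_add_distrib]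
    rw [add_comm]
    congr 1
    refine Finset.sum_congr rfl fun p hp => ?_
    rw [Nat.choose_symm_of_eq_add (Finset.HasAntidiagonal.mem_antidiagonal.mp hp).symm]

theorem divPow_apply [CharZero K] (D E : Derivation K A A) (n : ℕ) (a : A) :
    divPow D n (E a) = ∑ p ∈ Finset.HasAntidiagonal.antidiagonal n,
      (p.1.factorial : K)⁻¹ • adIter D E p.1 (divPow D p.2 a) := by
  rw [divPow, derivIter_apply, Finset.smul_sum]
  refine Finset.sum_congr rfl fun p hp => ?_
  rw [Finset.HasAntidiagonal.mem_antidiagonal] at hp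
  simp only [divPow, Derivation.map_smul, ← Nat.cast_smul_eq_nsmul K, smul_smul]
  congr 1
  subst hp
  rw [Nat.cast_add_choose]
  have := fun k : ℕ => (Nat.cast_ne_zero (R := K)).mpr k.factorial_ne_zero
  field_simp [this]

/-- The truncated exponential `∑_{j < N} ad(D)^j (E) / j!` of the adjoint action. -/
def adExp (D E : Derivation K A A) (N : ℕ) : Derivation K A A :=
  ∑ j ∈ Finset.range N, (j.factorial : K)⁻¹ • adIter D E j

theorem adExp_apply (D E : Derivation K A A) (N : ℕ) (a : A) :
    adExp D E N a = ∑ j ∈ Finset.range N, (j.factorial : K)⁻¹ • adIter D E j a := by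
  rw [adExp, ← Derivation.coeFnAddMonoidHom_apply, map_sum, Finset.sum_apply]
  rfl

theorem adExp_eq_of_le {D E : Derivation K A A} {N n : ℕ} (h : adIter D E N = 0) (hn : N ≤ n) :
    adExp D E n = adExp D E N := by
  rw [adExp, adExp]
  symm
  refine Finset.sum_subset (Finset.range_mono hn) fun j _ hj => ?_
  rw [adIter_eq_zero_of_le h (by simpa using hj), smul_zero]

/-- `exp(D) E exp(-D) = exp(ad D)(E)`. -/
theorem adExp_semiconj [CharZero K] {D E : Derivation K A A} (hD : IsLocallyNilpotent D) {N : ℕ}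
    (hN : adIter D E N = 0) (a : A) :
    adExp D E N (expAut D hD 1 a) = expAut D hD 1 (E a) := by
  change adExp D E N (expFun D 1 a) = expFun D 1 (E a)
  obtain ⟨n₀, hn₀⟩ := hD a
  -- A common bound for both indices, so that the sum over antidiagonals rearranges into a sum over
  -- a square.
  set n := max n₀ N
  have ha : ∀ k, n ≤ k → divPow D k a = 0 := fun k hk => divPow_eq_zero hn₀ (by omega)
  have hX : ∀ k, n ≤ k → adIter D E k = 0 := fun k hk => adIter_eq_zero_of_le hN (by omega)
  have hf : ∀ i j, n ≤ i ∨ n ≤ j →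
      (i.factorial : K)⁻¹ • adIter D E i (divPow D j a) = 0 := by
    rintro i j (h | h)
    · rw [hX i h, Derivation.zero_apply, smul_zero]
    · rw [ha j h, map_zero, smul_zero]
  have hEa : ∀ k, 2 * n ≤ k → divPow D k (E a) = 0 := by
    intro k hk
    rw [divPow_apply]
    refine Finset.sum_eq_zero fun p hp => hf _ _ ?_
    rw [Finset.HasAntidiagonal.mem_antidiagonal] at hp
    omega
  rw [expFun_eq D 1 ha, expFun_eq D 1 hEa, ← adExp_eq_of_le hN (le_max_right n₀ N)]
  simp only [one_pow, one_smul, divPow_apply]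
  rw [sum_antidiagonal_eq (fun i j => (i.factorial : K)⁻¹ • adIter D E i (divPow D j a)) n hf,
    adExp_apply]
  simp only [map_sum, Finset.smul_sum]
  rfl

end Adjoint

/-! ### Commutators of two root derivations. -/

section TwoRoots

variable {K : Type*} [Field K] {M : Type*} [AddCommGroup M] {σ : WeightCone M}

theorem HasSymbol.lie {D D' : Der K σ} {e e' : M} {ν ν' : M → K} (h : HasSymbol D e ν)
    (h' : HasSymbol D' e' ν') :
    HasSymbol ⁅D, D'⁆ (e' + e) fun m => ν' m * ν (m + e') - ν m * ν' (m + e) := by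
  have key : ∀ {D D' : Der K σ} {e e' : M} {ν ν' : M → K}, HasSymbol D e ν → HasSymbol D' e' ν' →
      ∀ m ∈ σ.monoid, D (D' (mono K σ m)) = (ν' m * ν (m + e')) • mono K σ (m + e' + e) ∧
        (ν' m * ν (m + e') ≠ 0 → m + e' + e ∈ σ.monoid) := by
    intro D D' e e' ν ν' h h' m hm
    by_cases h0 : ν' m = 0
    · simp [(h' m hm).1, h0]
    · have hmem := (h' m hm).2 h0
      rw [(h' m hm).1, Derivation.map_smul, (h _ hmem).1, smul_smul]
      exact ⟨rfl, fun hne => (h _ hmem).2 (right_ne_zero_of_mul hne)⟩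
  intro m hm
  obtain ⟨h1, h2⟩ := key h h' m hm
  obtain ⟨h3, h4⟩ := key h' h m hm
  rw [add_right_comm] at h3 h4
  rw [← add_assoc]
  refine ⟨by rw [Derivation.commutator_apply, h1, h3, sub_smul], fun hne => ?_⟩
  by_cases h0 : ν' m * ν (m + e') = 0
  · refine h4 fun h5 => hne ?_
    change _ - _ = _
    rw [h0, h5, sub_zero]
  · exact h2 h0

theorem HasSymbol.sub_eq_of_coeff_ne_zero {D : Der K σ} {e : M} {ν : M → K} (h : HasSymbol D e ν)
    {m q : σ.monoid} (hc : (D (chi m)).coeff q ≠ 0) : (q : M) - m = e := by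
  classical
  rw [← mono_coe, (h m m.2).1] at hc
  by_cases hmem : (m : M) + e ∈ σ.monoid
  · rw [mono_of_mem hmem, AddMonoidAlgebra.coeff_smul, Finsupp.smul_apply, coeff_chi] at hc
    have hq : (⟨m + e, hmem⟩ : σ.monoid) = q := by
      by_contra hne
      rw [if_neg hne, smul_zero] at hc
      exact hc rfl
    rw [← hq]
    simp
  · simp [mono, hmem] at hc

/-- Any `q` in the monoid with `e + q` in the monoid works, because `ρ e = -1`. Such an element
shows that root derivations are nonzero. -/
theorem IsDemazureRoot.exists_mem_pos {ρ : Module.Dual ℤ M} {e : M} (h : IsDemazureRoot σ ρ e) :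
    ∃ m ∈ σ.monoid, 0 < ρ m := by
  obtain ⟨q, hq, heq⟩ := σ.exists_add_mem e
  have h1 := h.ray.nonneg heq
  rw [map_add, h.apply_self] at h1
  exact ⟨q, hq, by omega⟩

variable [Module.Free ℤ M] [Module.Finite ℤ M]

theorem rootDerivation_ne_zero [CharZero K] {ρ : Module.Dual ℤ M} {e : M}
    (h : IsDemazureRoot σ ρ e) : rootDerivation K h ≠ 0 := by
  intro h0
  obtain ⟨m, hm, hpos⟩ := h.exists_mem_pos
  have h1 := (hasSymbol_rootDerivation (K := K) h m hm).1
  rw [h0, Derivation.zero_apply] at h1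
  exact smul_ne_zero (Int.cast_ne_zero.mpr hpos.ne') (mono_ne_zero (h.add_mem hm hpos.ne')) h1.symm

/-- The torus normalizes the root subgroups. -/
theorem torus_le_normalizer_rootSubgroup [CharZero K] {ρ : Module.Dual ℤ M} {e : M}
    (h : IsDemazureRoot σ ρ e) :
    torus K σ ≤ Subgroup.normalizer (rootSubgroup K h : Set (AutGroup K σ)) := by
  rintro _ ⟨t, rfl⟩
  -- A derivation of degree `e` is multiplied by `t(e)` under conjugation by `t`; `c` is the inverse
  -- of that factor.
  set c : Kˣ := (t (Multiplicative.ofAdd e))⁻¹ with hc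
  have hsemi : ∀ a, rootDerivation K h (torusAction t a) =
      (c : K) • torusAction t (rootDerivation K h a) := by
    have : (rootDerivation K h : CoordRing K σ →ₗ[K] CoordRing K σ) ∘ₗ (torusHom t).toLinearMap =
        (c : K) • ((torusHom t).toLinearMap ∘ₗ
          (rootDerivation K h : CoordRing K σ →ₗ[K] CoordRing K σ)) := by
      refine linearMap_ext_chi fun m => ?_
      simp only [LinearMap.comp_apply, AlgHom.toLinearMap_apply, LinearMap.smul_apply, torusHom_chi,
        map_smul, Derivation.coeFn_coe]
      by_cases hm : ρ m = 0
      · rw [rootDerivation_chi_of_eq h m hm, map_zero, smul_zero, smul_zero]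
      · rw [rootDerivation_chi_of_ne h m hm, map_smul, torusHom_chi, smul_smul, smul_smul, smul_smul]
        congr 1
        rw [ofAdd_add, map_mul, Units.val_mul, hc]
        have := Units.inv_mul (t (Multiplicative.ofAdd e))
        linear_combination (-(ρ m : K) * (t (Multiplicative.ofAdd (m : M)) : K)) * this
    exact fun a => congr($this a)
  have hconj : ∀ s : K, expAut _ (rootDerivation_isLocallyNilpotent h) s = torusAction t *
      expAut _ (rootDerivation_isLocallyNilpotent h) ((c : K) * s) * (torusAction t)⁻¹ :=
    expAut_semiconj _ _ _ _ hsemi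
  refine Subgroup.mem_normalizer_iff.mpr fun x => ⟨?_, ?_⟩
  · rintro ⟨s, rfl⟩
    refine ⟨((c⁻¹ : Kˣ) : K) * s, ?_⟩
    rw [hconj, Units.mul_inv_cancel_left]
  · rintro ⟨s, hs⟩
    refine ⟨c * s, ?_⟩
    rw [hconj] at hs
    exact mul_left_cancel (mul_right_cancel hs)

/-- On `e₂ + δ e₁` the form `ρ₁` takes the value `(δ - 1) - δ = -1`, every ray other than `ρ₁`, `ρ₂`
is nonnegative, and `ρ₂` takes the value `δ ⟨ρ₂,e₁⟩ - 1`. As `δ ≥ 1`, only the last value imposes a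
condition. -/
theorem isDemazureRoot_add_zsmul_iff {ρ₁ ρ₂ : Module.Dual ℤ M} {e₁ e₂ : M}
    (h₁ : IsDemazureRoot σ ρ₁ e₁) (h₂ : IsDemazureRoot σ ρ₂ e₂) (hne : ρ₁ ≠ ρ₂) :
    IsDemazureRoot σ ρ₁ (e₂ + (ρ₁ e₂ + 1) • e₁) ↔ 1 ≤ ρ₂ e₁ := by
  have hδ := h₂.nonneg ρ₁ h₁.ray hne
  have happ : ∀ ρ : Module.Dual ℤ M, ρ (e₂ + (ρ₁ e₂ + 1) • e₁) = ρ e₂ + (ρ₁ e₂ + 1) * ρ e₁ :=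
    fun ρ => by rw [map_add, map_zsmul, smul_eq_mul]
  refine ⟨fun h => ?_, fun h => ⟨h₁.ray, ?_, fun ρ hρ hρ₁ => ?_⟩⟩
  · have := h.nonneg ρ₂ h₂.ray hne.symm
    rw [happ, h₂.apply_self] at this
    by_contra hcon
    nlinarith
  · rw [happ, h₁.apply_self]
    ring
  · rw [happ]
    have h3 := h₁.nonneg ρ hρ hρ₁
    by_cases hρ₂ : ρ = ρ₂
    · subst hρ₂
      rw [h₂.apply_self]
      nlinarith
    · have h4 := h₂.nonneg ρ hρ hρ₂
      nlinarith

/-- A bracket with `∂_{ρ₁,e₁}` turns the coefficients `(α, β)` of `α ρ₂ + β ρ₁` into `((δ-1-j) α,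
(δ-j) β - α ⟨ρ₂,e₁⟩)`. Thus `α` stays positive until `j = δ`, where it becomes zero, while `β`
becomes negative at `j = 1` and remains so. -/
theorem hasSymbol_adIter_rootDerivation {ρ₁ ρ₂ : Module.Dual ℤ M} {e₁ e₂ : M}
    (h₁ : IsDemazureRoot σ ρ₁ e₁) (h₂ : IsDemazureRoot σ ρ₂ e₂) {d : ℕ} (hd : (d : ℤ) = ρ₁ e₂ + 1)
    (hb : 1 ≤ ρ₂ e₁) (j : ℕ) (hj : j ≤ d) :
    ∃ α β : ℤ, HasSymbol (adIter (rootDerivation K h₁) (rootDerivation K h₂) j) (e₂ + j • e₁)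
      (fun m => ((α * ρ₂ m + β * ρ₁ m : ℤ) : K)) ∧ (j < d → 0 < α) ∧ (j = d → 0 < d → α = 0) ∧
        β ≤ 0 ∧ (1 ≤ j → β < 0) := by
  induction j with
  | zero =>
    refine ⟨1, 0, ?_, fun _ => one_pos, fun h h' => absurd h' (by omega), le_rfl,
      fun h => absurd h (by omega)⟩
    rw [adIter_zero, zero_smul, add_zero]
    exact (hasSymbol_rootDerivation h₂).congr fun m _ => by simp
  | succ j ih =>
    obtain ⟨α, β, hsym, hα, -, hβ, -⟩ := ih (by omega)
    have hαpos := hα (by omega)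
    refine ⟨(d - 1 - j) * α, (d - j) * β - α * ρ₂ e₁, ?_, fun h => ?_, fun h _ => ?_, ?_, fun _ => ?_⟩
    · rw [adIter_succ, succ_nsmul, ← add_assoc]
      refine ((hasSymbol_rootDerivation h₁).lie hsym).congr fun m _ => ?_
      simp only [map_add, map_nsmul, h₁.apply_self, nsmul_eq_mul]
      have hd' : (d : K) = ρ₁ e₂ + 1 := by exact_mod_cast congrArg (Int.cast : ℤ → K) hd
      push_cast
      rw [hd']
      ring
    · have : (0 : ℤ) < d - 1 - j := by omega
      positivity
    · have : (d : ℤ) - 1 - j = 0 := by omega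
      rw [this, zero_mul]
    · have : (0 : ℤ) ≤ d - j := by omega
      nlinarith
    · have : (0 : ℤ) ≤ d - j := by omega
      nlinarith

/-- The derivation `∂_{ρ₁, e₂ + δ e₁}` is the last nonzero iterated commutator, up to a factor. -/
theorem adIter_rootDerivation [CharZero K] {ρ₁ ρ₂ : Module.Dual ℤ M} {e₁ e₂ : M}
    (h₁ : IsDemazureRoot σ ρ₁ e₁) (h₂ : IsDemazureRoot σ ρ₂ e₂) {d : ℕ} (hd : (d : ℤ) = ρ₁ e₂ + 1)
    (hd0 : 0 < d) (hb : 1 ≤ ρ₂ e₁) (h : IsDemazureRoot σ ρ₁ (e₂ + d • e₁)) :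
    adIter (rootDerivation K h₁) (rootDerivation K h₂) (d + 1) = 0 ∧
      ∃ c : K, c ≠ 0 ∧
        adIter (rootDerivation K h₁) (rootDerivation K h₂) d = c • rootDerivation K h := by
  obtain ⟨α, β, hsym, -, hα, -, hβ⟩ := hasSymbol_adIter_rootDerivation (K := K) h₁ h₂ hd hb d le_rfl
  obtain rfl := hα rfl hd0
  have heq : adIter (rootDerivation K h₁) (rootDerivation K h₂) d = (β : K) • rootDerivation K h :=
    hsym.unique (((hasSymbol_rootDerivation h).smul _).congr fun m _ => by simp)
  refine ⟨?_, β, Int.cast_ne_zero.mpr (hβ hd0).ne, heq⟩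
  rw [adIter_succ]
  -- At `j = d` the symbol is `β ρ₁`, and `ρ₁` equals `-1` on both degrees `e₁` and `e₂ + d e₁`, so
  -- the two terms of the bracket cancel.
  have hlie := ((hasSymbol_rootDerivation (K := K) h₁).lie hsym).congr (ν' := fun _ => 0) fun m _ => by
    simp only [map_add, map_nsmul, h₁.apply_self, nsmul_eq_mul]
    have hd' : (d : K) = ρ₁ e₂ + 1 := by exact_mod_cast congrArg (Int.cast : ℤ → K) hd
    push_cast
    rw [hd']
    ring
  refine der_ext_chi fun m => ?_
  rw [← mono_coe, (hlie m m.2).1, zero_smul, Derivation.zero_apply]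

/-- The derivation `F = exp(∂₁) ∂₂ exp(-∂₁)` has its one-parameter group in the generated group, and
its component of degree `e₂ + d e₁` is a nonzero multiple of the desired root derivation. -/
theorem rootSubgroup_subset_indClosure_sup [CharZero K] {r : ℕ} {a : Fin r → CoordRing K σ}
    (ha : Algebra.adjoin K (Set.range a) = ⊤) {ρ₁ ρ₂ : Module.Dual ℤ M} {e₁ e₂ : M}
    (h₁ : IsDemazureRoot σ ρ₁ e₁) (h₂ : IsDemazureRoot σ ρ₂ e₂) {d : ℕ} (hd : (d : ℤ) = ρ₁ e₂ + 1)
    (hd0 : 0 < d) (hb : 1 ≤ ρ₂ e₁) (h : IsDemazureRoot σ ρ₁ (e₂ + d • e₁)) :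
    (rootSubgroup K h : Set (AutGroup K σ)) ⊆ indClosure a
      ((rootSubgroup K h₁ ⊔ rootSubgroup K h₂ : Subgroup (AutGroup K σ)) :
        Set (AutGroup K σ)) := by
  classical
  set G : Subgroup (AutGroup K σ) := rootSubgroup K h₁ ⊔ rootSubgroup K h₂ with hG
  set X := adIter (rootDerivation K h₁) (rootDerivation K h₂) with hX
  set F := adExp (rootDerivation K h₁) (rootDerivation K h₂) (d + 1) with hF
  obtain ⟨hX0, c, hc, hXd⟩ := adIter_rootDerivation (K := K) h₁ h₂ hd hd0 hb h
  have hsemi := adExp_semiconj (rootDerivation_isLocallyNilpotent h₁) hX0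
  have hFLN : IsLocallyNilpotent F := (rootDerivation_isLocallyNilpotent h₂).of_semiconj
    (expAut _ (rootDerivation_isLocallyNilpotent h₁) 1) 1 fun a => by rw [one_smul, hF, hsemi]
  have hFG : expSubgroup F hFLN ≤ G :=
    expSubgroup_le_of_semiconj (rootDerivation_isLocallyNilpotent h₂) hFLN
      (expAut _ (rootDerivation_isLocallyNilpotent h₁) 1) 1 (fun a => by rw [one_smul, hF, hsemi])
      (le_sup_right : rootSubgroup K h₂ ≤ G)
      (Subgroup.le_normalizer ((le_sup_left : rootSubgroup K h₁ ≤ G) ⟨1, rfl⟩))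
  have hnorm : torus K σ ≤ Subgroup.normalizer (G : Set (AutGroup K σ)) :=
    (le_inf (torus_le_normalizer_rootSubgroup h₁) (torus_le_normalizer_rootSubgroup h₂)).trans
      (Subgroup.normalizer_inf_normalizer_le_normalizer_sup _ _)
  have hcoeff : ∀ j ≤ d, ∀ m q : σ.monoid, (X j (chi m)).coeff q ≠ 0 → (q : M) - m = e₂ + j • e₁ := by
    intro j hj m q hne
    obtain ⟨α, β, hsym, -⟩ := hasSymbol_adIter_rootDerivation (K := K) h₁ h₂ hd hb j hj
    exact hsym.sub_eq_of_coeff_ne_zero hne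
  have hFcoeff : ∀ m q : σ.monoid, (F (chi m)).coeff q =
      ∑ j ∈ Finset.range (d + 1), (j.factorial : K)⁻¹ * (X j (chi m)).coeff q := by
    intro m q
    rw [hF, adExp_apply, AddMonoidAlgebra.coeff_sum, Finsupp.finsetSum_apply]
    rfl
  have hρ : ∀ j : ℕ, ρ₁ (e₂ + j • e₁) = ρ₁ e₂ - j := fun j => by
    rw [map_add, map_nsmul, h₁.apply_self]
    simp [sub_eq_add_neg]
  -- The degrees `e₂ + j e₁` are distinct, since `ρ₁` takes different values on them, so the
  -- component is exactly the term `j = d`.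
  have hcomp : component F {e₂ + d • e₁} = ((d.factorial : K)⁻¹ * c) • rootDerivation K h := by
    rw [mul_smul, ← hXd]
    refine der_ext_chi fun m => AddMonoidAlgebra.ext (Finsupp.ext fun q => ?_)
    rw [coeff_component_chi, Derivation.smul_apply, AddMonoidAlgebra.coeff_smul, Finsupp.smul_apply,
      smul_eq_mul, hFcoeff]
    split_ifs with hq
    · refine Finset.sum_eq_single d (fun j hj hjd => ?_) fun hj => absurd (by simp) hj
      rw [Finset.mem_range] at hj
      by_contra hne
      have h3 := hcoeff j (by omega) m q (right_ne_zero_of_mul hne)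
      have h4 := congrArg ρ₁ (h3.symm.trans hq)
      rw [hρ, hρ] at h4
      omega
    · by_contra hne
      exact hq (hcoeff d le_rfl m q (right_ne_zero_of_mul (Ne.symm hne)))
  have hc' : (d.factorial : K)⁻¹ * c ≠ 0 :=
    mul_ne_zero (inv_ne_zero (Nat.cast_ne_zero.mpr d.factorial_ne_zero)) hc
  have hdeg : e₂ + d • e₁ ∈ degrees F := by
    change component F {e₂ + d • e₁} ≠ 0
    rw [hcomp]
    exact smul_ne_zero hc' (rootDerivation_ne_zero h)
  have hFne : F ≠ 0 := by
    intro h0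
    obtain ⟨m, q, -, hne⟩ := exists_coeff_ne_zero hdeg
    rw [h0] at hne
    exact hne rfl
  -- The values `ρ₁(e₂ + j e₁) = ρ₁ e₂ - j` decrease with `j`; the sign in `-ρ₁` selects the last
  -- term as the principal one.
  have hpp : principalPart F (-ρ₁) = ((d.factorial : K)⁻¹ * c) • rootDerivation K h := by
    rw [← hcomp]
    refine principalPart_eq_component_singleton hdeg fun e he hne => ?_
    obtain ⟨m, q, hq, hne0⟩ := exists_coeff_ne_zero he
    rw [hFcoeff] at hne0
    obtain ⟨j, hj, hj0⟩ := Finset.exists_ne_zero_of_sum_ne_zero hne0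
    rw [Finset.mem_range] at hj
    have h3 := hcoeff j (by omega) m q (right_ne_zero_of_mul hj0)
    rw [hq] at h3
    have hjd : j ≠ d := by
      rintro rfl
      exact hne h3
    rw [h3, LinearMap.neg_apply, LinearMap.neg_apply, hρ, hρ]
    omega
  have hT : oneParamSubgroup K σ (-ρ₁) ≤ Subgroup.normalizer (G : Set (AutGroup K σ)) := by
    refine le_trans ?_ hnorm
    rintro _ ⟨s, rfl⟩
    exact ⟨_, rfl⟩
  obtain ⟨-, hLN, hsub⟩ := principalPart_expSubgroup_subset ha hT hFLN hFne hFG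
  exact fun x hx => hsub (rootSubgroup_le_expSubgroup h hLN hc' hpp hx)

end TwoRoots

end ToricRoots

end

theorem mainTheorem7 {K : Type*} [Field K] [IsAlgClosed K] [CharZero K]
    {M : Type*} [AddCommGroup M] [Module.Free ℤ M] [Module.Finite ℤ M]
    (σ : ToricRoots.WeightCone M)
    {r : ℕ} (a : Fin r → ToricRoots.CoordRing K σ)
    (ha : Algebra.adjoin K (Set.range a) = ⊤) :
    -- principal parts
    (∀ (G : Subgroup (ToricRoots.AutGroup K σ))
        (ρ : Module.Dual ℤ M),
      ToricRoots.oneParamSubgroup K σ ρ ≤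
        Subgroup.normalizer (G : Set (ToricRoots.AutGroup K σ)) →
      ∀ (D : ToricRoots.Der K σ)
        (hD : ToricRoots.IsLocallyNilpotent D),
        D ≠ 0 → ToricRoots.expSubgroup D hD ≤ G →
        ToricRoots.principalPart D ρ ≠ 0 ∧
        ∃ hT : ToricRoots.IsLocallyNilpotent (ToricRoots.principalPart D ρ),
          (ToricRoots.expSubgroup (ToricRoots.principalPart D ρ) hT : Set (ToricRoots.AutGroup K σ)) ⊆
            ToricRoots.indClosure a (G : Set (ToricRoots.AutGroup K σ))) ∧
    -- vertices of the Newton polytope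
    (∀ G : Subgroup (ToricRoots.AutGroup K σ),
      ToricRoots.torus K σ ≤
        Subgroup.normalizer (G : Set (ToricRoots.AutGroup K σ)) →
      ∀ (D : ToricRoots.Der K σ)
        (hD : ToricRoots.IsLocallyNilpotent D),
        D ≠ 0 → ToricRoots.expSubgroup D hD ≤ G →
        ∀ v ∈ (ToricRoots.newtonPolytope D).extremePoints ℚ,
          ∃ e : M, ToricRoots.toRat e = v ∧
            ∃ (ρ : Module.Dual ℤ M) (he : ToricRoots.IsDemazureRoot σ ρ e),
              (ToricRoots.rootSubgroup K he : Set (ToricRoots.AutGroup K σ)) ⊆ ToricRoots.indClosure a (G : Set (ToricRoots.AutGroup K σ))) ∧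
    -- two roots
    (∀ (ρ₁ ρ₂ : Module.Dual ℤ M) (e₁ e₂ : M) (h₁ : ToricRoots.IsDemazureRoot σ ρ₁ e₁)
        (h₂ : ToricRoots.IsDemazureRoot σ ρ₂ e₂) (δ : ℤ),
      ρ₁ ≠ ρ₂ → δ = ρ₁ e₂ + 1 →
      (ToricRoots.IsDemazureRoot σ ρ₁ (e₂ + δ • e₁) ↔ 1 ≤ ρ₂ e₁) ∧
      (1 ≤ ρ₂ e₁ →
        ∃ h : ToricRoots.IsDemazureRoot σ ρ₁ (e₂ + δ • e₁),
          (ToricRoots.rootSubgroup K h : Set (ToricRoots.AutGroup K σ)) ⊆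
            ToricRoots.indClosure a
              ((ToricRoots.rootSubgroup K h₁ ⊔ ToricRoots.rootSubgroup K h₂ :
                Subgroup (ToricRoots.AutGroup K σ)) : Set (ToricRoots.AutGroup K σ)))) := by
  refine ⟨fun G ρ hG D hD hne hDG => ToricRoots.principalPart_expSubgroup_subset ha hG hD hne hDG,
    fun G hG D hD hne hDG v hv =>
      ToricRoots.rootSubgroup_subset_indClosure_of_vertex ha hG hD hne hDG hv,
    fun ρ₁ ρ₂ e₁ e₂ h₁ h₂ δ hρ hδ => ?_⟩
  subst hδ
  have hiff := ToricRoots.isDemazureRoot_add_zsmul_iff h₁ h₂ hρ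
  refine ⟨hiff, fun hb => ⟨hiff.mpr hb, ?_⟩⟩
  have h := hiff.mpr hb
  have hnonneg := h₂.nonneg ρ₁ h₁.ray hρ
  obtain ⟨d, hd⟩ := Int.eq_ofNat_of_zero_le (show 0 ≤ ρ₁ e₂ + 1 by omega)
  -- Root subgroups depend on a proof about the lattice point. Generalizing it to `f` allows the
  -- passage from the integer multiple `δ • e₁` to the natural multiple `d • e₁`.
  have hsub : ∀ (f : M) (hf : f = e₂ + d • e₁) (hroot : ToricRoots.IsDemazureRoot σ ρ₁ f),
      (ToricRoots.rootSubgroup K hroot : Set (ToricRoots.AutGroup K σ)) ⊆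
        ToricRoots.indClosure a
          ((ToricRoots.rootSubgroup K h₁ ⊔ ToricRoots.rootSubgroup K h₂ :
            Subgroup (ToricRoots.AutGroup K σ)) : Set (ToricRoots.AutGroup K σ)) := by
    rintro f rfl hroot
    exact ToricRoots.rootSubgroup_subset_indClosure_sup ha h₁ h₂ hd.symm (by omega) hb hroot
  exact hsub _ (by rw [hd, natCast_zsmul]) h
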